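/- Let $G=\mathbb Z^2\rtimes_A\mathbb Z$ with $A=\begin{pmatrix}2&1\\1&1\end{pmatrix}$, i.e. the set of triples $((m,k),n)$ of integers with $((m,k),n)\cdot((m',k'),n')=((m,k)+A^n(m',k'),\,n+n')$, and let $\varphi$ be the automorphism $\varphi((m,k),n)=((k,-m),-n)$ of $G$. Let $R(\varphi)$ be the number of twisted conjugacy classes of $\varphi$, i.e. of classes of the equivalence relation $x\sim g\,x\,\varphi(g^{-1})$ ($g\in G$). Let $\widehat G$ be the unitary dual (equivalence classes of irreducible unitary representations), and let $\widehat\varphi:\widehat G\to\widehat G$, $[\rho]\mapsto[\rho\circ\varphi]$. Then: (1) $R(\varphi)=4$. (2) $\widehat\varphi$ has exactly four finite-dimensional fixed points in $\widehat G$, namely the (pairwise distinct) classes of the irreducible representations $\rho_1$, $\pi$, $\rho_2$, $\rho_2\otimes\pi$. Here $\rho_1$ is the trivial one-dimensional representation; $\pi$ is the one-dimensional representation $\pi((m,k),n)=(-1)^n$; and $\rho_2$ is the representation on $\mathbb C^3$ with orthonormal basis $\varepsilon_1,\varepsilon_2,\varepsilon_3$ (indices mod $3$) in which $((0,0),n)$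 maps $\varepsilon_i$ to $\varepsilon_{i+n}$ and $((m,k),0)$ multiplies $\varepsilon_1,\varepsilon_2,\varepsilon_3$ by $(-1)^k$, $(-1)^m$, $(-1)^{m+k}$ respectively. (3) The representation $\rho$ of $G$ on $L^2(\mathbb T^2)$ (Lebesgue measure, $\mathbb T=\mathbb R/\mathbb Z$), $(\rho((m,k),n)f)(x)=e^{2\pi i\langle (m,k),x\rangle}f(A^nx)$, is an infinite-dimensional irreducible unitary representation whose class is a fixed point of $\widehat\varphi$. (4) Consequently $R(\varphi)<\#\operatorname{Fix}(\widehat\varphi)$, where $\operatorname{Fix}(\widehat\varphi)$ is the set of fixed points of $\widehat\varphi$ in all of $\widehat G$. In particular the original conjecture of Fel'shtyn and Hill (for every automorphism $\varphi$ of a countable discrete group, if one of $R(\varphi)$ and $\#\operatorname{Fix}(\widehat\varphi)$ is finite, then it is equal to the other) is false. -/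

import Mathlib

open MeasureTheory
open scoped MatrixGroups

universe u

/-! ### Twisted conjugacy -/

/-- Twisted conjugacy: `x ∼ x'` iff `x' = g x φ(g⁻¹)` for some `g`. -/
def twistedConjSetoid {G : Type*} [Group G] (φ : G →* G) : Setoid G where
  r x x' := ∃ g : G, x' = g * x * φ g⁻¹
  iseqv :=
    { refl := fun x => ⟨1, by simp⟩
      symm := by
        rintro x _ ⟨g, rfl⟩
        exact ⟨g⁻¹, by simp [mul_assoc]⟩
      trans := by
        rintro x _ _ ⟨g, rfl⟩ ⟨h, rfl⟩
        exact ⟨h * g, by simp [mul_assoc]⟩ }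

/-- The Reidemeister number `R(φ)`: the number (possibly `∞`) of twisted conjugacy classes. -/
noncomputable def reidemeisterNumber {G : Type*} [Group G] (φ : G →* G) : ℕ∞ :=
  ENat.card (Quotient (twistedConjSetoid φ))

/-! ### Unitary representations and the unitary dual of a discrete group -/

/-- A unitary representation of the discrete group `G` on the Hilbert space `H`: a homomorphism
into the group of unitary operators (surjective linear isometries) of `H`. -/
abbrev UnitaryRep (G : Type*) [Group G] (H : Type*) [NormedAddCommGroup H]
    [InnerProductSpace ℂ H] : Type _ :=
  G →* (H ≃ₗᵢ[ℂ] H)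

namespace UnitaryRep

variable {G : Type*} [Group G]
variable {H : Type*} [NormedAddCommGroup H] [InnerProductSpace ℂ H]
variable {K : Type*} [NormedAddCommGroup K] [InnerProductSpace ℂ K]

/-- Topological irreducibility: `H ≠ 0` and the only closed invariant subspaces are `0`, `H`. -/
def IsIrreducible (ρ : UnitaryRep G H) : Prop :=
  Nontrivial H ∧ ∀ W : Submodule ℂ H, IsClosed (W : Set H) →
    (∀ g : G, ∀ v ∈ W, ρ g v ∈ W) → W = ⊥ ∨ W = ⊤

/-- Unitary equivalence. -/
def Equivalent (ρ : UnitaryRep G H) (σ : UnitaryRep G K) : Prop :=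
  ∃ S : H ≃ₗᵢ[ℂ] K, ∀ (g : G) (v : H), S (ρ g v) = σ g (S v)

/-- `ρ ∘ φ` is irreducible if `ρ` is, for an automorphism `φ`. -/
theorem IsIrreducible.comp {ρ : UnitaryRep G H} (h : IsIrreducible ρ) (φ : G ≃* G) :
    IsIrreducible (MonoidHom.comp ρ φ.toMonoidHom : UnitaryRep G H) := by
  refine ⟨h.1, fun W hW hinv => h.2 W hW fun g v hv => ?_⟩
  have := hinv (φ.symm g) v hv
  simpa using this

/-- A family of linear isometries which is multiplicative in `g` is a unitary representation. -/
def ofIsometries (U : G → H →ₗᵢ[ℂ] H) (h_one : ∀ v, U 1 v = v)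
    (h_mul : ∀ g h v, U (g * h) v = U g (U h v)) : UnitaryRep G H where
  toFun g :=
    { toLinearEquiv := LinearEquiv.ofLinearMap (U g).toLinearMap (U g⁻¹).toLinearMap
        (by ext v; simp [← h_mul, h_one]) (by ext v; simp [← h_mul, h_one])
      norm_map' := fun v => (U g).norm_map v }
  map_one' := by ext v; exact h_one v
  map_mul' g h := by ext v; exact h_mul g h v

/-- The one-dimensional representation given by a unitary character. -/
noncomputable def ofCharacter (χ : G →* Circle) : UnitaryRep G ℂ :=
  ofIsometries
    (fun g =>
      { toFun := fun z => (χ g : ℂ) * z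
        map_add' := fun z w => mul_add _ z w
        map_smul' := fun c z => by simp; ring
        norm_map' := fun z => by simp [Circle.norm_coe] })
    (fun z => by change ((χ 1 : Circle) : ℂ) * z = z; simp)
    (fun g h z => by
      change ((χ (g * h) : Circle) : ℂ) * z = (χ g : ℂ) * ((χ h : ℂ) * z)
      simp [mul_assoc])

/-- The tensor product `ρ ⊗ χ` of `ρ` with a unitary character, realised on `H = H ⊗ ℂ`. -/
noncomputable def twist (ρ : UnitaryRep G H) (χ : G →* Circle) : UnitaryRep G H :=
  ofIsometries
    (fun g =>
      { toFun := fun v => (χ g : ℂ) • ρ g v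
        map_add' := fun v w => by simp
        map_smul' := fun c v => by simp [smul_comm c]
        norm_map' := fun v => by simp [norm_smul, Circle.norm_coe] })
    (fun v => by change ((χ 1 : Circle) : ℂ) • ρ 1 v = v; simp)
    (fun g h v => by
      change ((χ (g * h) : Circle) : ℂ) • ρ (g * h) v = (χ g : ℂ) • ρ g ((χ h : ℂ) • ρ h v)
      simp [mul_smul])

end UnitaryRep

/-- An irreducible unitary representation together with its Hilbert space. Every irreducible
unitary representation of `G : Type u` lives, up to equivalence, on a Hilbert space in
`Type u`, because it has a dense subspace spanned by one orbit of `G`. -/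
structure UnitaryIrrep (G : Type u) [Group G] : Type (u + 1) where
  space : Type u
  [normedAddCommGroup : NormedAddCommGroup space]
  [innerProductSpace : InnerProductSpace ℂ space]
  [completeSpace : CompleteSpace space]
  rep : UnitaryRep G space
  irreducible : UnitaryRep.IsIrreducible rep

attribute [instance] UnitaryIrrep.normedAddCommGroup UnitaryIrrep.innerProductSpace
  UnitaryIrrep.completeSpace

/-- Unitary equivalence of irreducible representations. -/
instance unitaryIrrepSetoid (G : Type u) [Group G] : Setoid (UnitaryIrrep G) where
  r ρ σ := UnitaryRep.Equivalent ρ.rep σ.rep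
  iseqv :=
    { refl := fun ρ => ⟨LinearIsometryEquiv.refl ℂ ρ.space, fun _ _ => rfl⟩
      symm := by
        rintro ρ σ ⟨S, hS⟩
        exact ⟨S.symm, fun g v => by
          rw [LinearIsometryEquiv.symm_apply_eq, hS, S.apply_symm_apply]⟩
      trans := by
        rintro ρ σ τ ⟨S, hS⟩ ⟨T, hT⟩
        exact ⟨S.trans T, fun g v => by simp [hS, hT]⟩ }

/-- The unitary dual of `G`: equivalence classes of irreducible unitary representations. -/
def UnitaryDual (G : Type u) [Group G] : Type (u + 1) :=
  Quotient (unitaryIrrepSetoid G)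

namespace UnitaryDual

variable {G : Type u} [Group G]

/-- The class in the unitary dual of an irreducible unitary representation. -/
def mk {H : Type u} [NormedAddCommGroup H] [InnerProductSpace ℂ H] [CompleteSpace H]
    (ρ : UnitaryRep G H) (h : UnitaryRep.IsIrreducible ρ) : UnitaryDual G :=
  Quotient.mk (unitaryIrrepSetoid G) { space := H, rep := ρ, irreducible := h }

/-- The map `[ρ] ↦ [ρ ∘ φ]` of the unitary dual induced by an automorphism `φ`. -/
def map (φ : G ≃* G) : UnitaryDual G → UnitaryDual G :=
  Quotient.map
    (fun ρ =>
      { space := ρ.space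
        rep := MonoidHom.comp ρ.rep φ.toMonoidHom
        irreducible := ρ.irreducible.comp φ })
    (by
      rintro ρ σ ⟨S, hS⟩
      exact ⟨S, fun g v => hS (φ g) v⟩)

/-- The set of fixed points of the induced map of the unitary dual. -/
def fix (φ : G ≃* G) : Set (UnitaryDual G) :=
  Function.fixedPoints (map φ)

/-- The classes of the finite-dimensional irreducible unitary representations. -/
def finiteDimensional (G : Type u) [Group G] : Set (UnitaryDual G) :=
  {x | ∃ ρ : UnitaryIrrep G, FiniteDimensional ℂ ρ.space ∧
    Quotient.mk (unitaryIrrepSetoid G) ρ = x}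

end UnitaryDual

/-- The original conjecture of Fel'shtyn and Hill: for every automorphism `φ` of a countable
discrete group, if one of `R(φ)` and `# Fix φ̂` is finite, then it is equal to the other. -/
def FelshtynHillConjecture : Prop :=
  ∀ (G : Type) [Group G] [Countable G] (φ : G ≃* G),
    reidemeisterNumber φ.toMonoidHom < ⊤ ∨ (UnitaryDual.fix φ).encard < ⊤ →
      reidemeisterNumber φ.toMonoidHom = (UnitaryDual.fix φ).encard

/-! ### The group `G = ℤ² ⋊ ℤ` and its automorphism -/

namespace Anosov

/-- The linear action `x ↦ B x` of an integer matrix on `M²`, for an abelian group `M`. -/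
def act {M : Type*} [AddCommGroup M] (B : Matrix (Fin 2) (Fin 2) ℤ) : (Fin 2 → M) →+ (Fin 2 → M)
    where
  toFun x i := ∑ j, B i j • x j
  map_zero' := by ext; simp
  map_add' x y := by ext; simp [add_add_add_comm]

theorem act_one {M : Type*} [AddCommGroup M] (x : Fin 2 → M) :
    act (1 : Matrix (Fin 2) (Fin 2) ℤ) x = x := by
  ext i; fin_cases i <;> simp [act]

theorem act_mul {M : Type*} [AddCommGroup M] (B C : Matrix (Fin 2) (Fin 2) ℤ) (x : Fin 2 → M) :
    act (B * C) x = act B (act C x) := by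
  ext i
  simp [act, Matrix.mul_apply, add_smul, mul_smul]
  abel

/-- The Anosov matrix. -/
def A : SL(2, ℤ) := ⟨!![2, 1; 1, 1], by simp [Matrix.det_fin_two]⟩

/-- The matrix of the restriction of the automorphism to `ℤ²`. -/
def M : SL(2, ℤ) := ⟨!![0, 1; -1, 0], by simp [Matrix.det_fin_two]⟩

/-- The action of an element of `SL(2, ℤ)` on `ℤ²`, as an automorphism of the group `ℤ²`
(written multiplicatively). -/
def slAut : SL(2, ℤ) →* MulAut (Multiplicative (Fin 2 → ℤ)) where
  toFun B := AddEquiv.toMultiplicative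
    { toFun := act B.1
      invFun := act (B⁻¹).1
      left_inv := fun x => by rw [← act_mul, ← Matrix.SpecialLinearGroup.coe_mul]; simp [act_one]
      right_inv := fun x => by rw [← act_mul, ← Matrix.SpecialLinearGroup.coe_mul]; simp [act_one]
      map_add' := map_add _ }
  map_one' := by
    ext1 x
    exact congrArg Multiplicative.ofAdd (act_one x.toAdd)
  map_mul' B C := by
    ext1 x
    exact congrArg Multiplicative.ofAdd (act_mul B.1 C.1 x.toAdd)

/-- The group `G = ℤ² ⋊ ℤ`, where `n : ℤ` acts on `ℤ²` by `A ^ n`; the product is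
`(v, n) * (v', n') = (v + A ^ n v', n + n')`. -/
abbrev G : Type :=
  Multiplicative (Fin 2 → ℤ) ⋊[slAut.comp (zpowersHom SL(2, ℤ) A)] Multiplicative ℤ

/-- The vector part `(m, k)` of `((m, k), n) : G`. -/
def vec (g : G) : Fin 2 → ℤ := g.left.toAdd

/-- The integer part `n` of `((m, k), n) : G`. -/
def lvl (g : G) : ℤ := g.right.toAdd

/-- The element `((m, k), n)` of `G`. -/
def elt (m k n : ℤ) : G := ⟨Multiplicative.ofAdd ![m, k], Multiplicative.ofAdd n⟩

theorem vec_mul (g h : G) : vec (g * h) = vec g + act (A ^ lvl g).1 (vec h) := rfl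

theorem lvl_mul (g h : G) : lvl (g * h) = lvl g + lvl h := rfl

theorem vec_one : vec 1 = 0 := rfl

theorem lvl_one : lvl 1 = 0 := rfl

theorem M_mul_A_zpow (n : ℤ) : M * A ^ n = A ^ (-n) * M := by
  have h : M * A * M⁻¹ = A⁻¹ := by decide
  have h2 := conj_zpow (i := n) (a := M) (b := A)
  rw [h, inv_zpow'] at h2
  rw [h2]; group

/-- The automorphism `((m, k), n) ↦ ((k, -m), -n)` of `G`. -/
def phi : G ≃* G where
  toFun g := elt (vec g 1) (-vec g 0) (-lvl g)
  invFun g := elt (-vec g 1) (vec g 0) (-lvl g)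
  left_inv g := by
    refine SemidirectProduct.ext ?_ ?_
    · refine Multiplicative.toAdd.injective ?_
      ext i; fin_cases i <;> simp [elt, vec]
    · simp [elt, lvl]
  right_inv g := by
    refine SemidirectProduct.ext ?_ ?_
    · refine Multiplicative.toAdd.injective ?_
      ext i; fin_cases i <;> simp [elt, vec]
    · simp [elt, lvl]
  map_mul' g h := by
    have hM : ∀ v : Fin 2 → ℤ, ![v 1, -v 0] = act M.1 v := by
      intro v; ext i; fin_cases i <;> simp [act, M]
    refine SemidirectProduct.ext ?_ ?_
    · refine Multiplicative.toAdd.injective ?_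
      change ![vec (g * h) 1, -vec (g * h) 0] =
        ![vec g 1, -vec g 0] + act (A ^ (-lvl g)).1 ![vec h 1, -vec h 0]
      rw [hM, hM, hM, vec_mul, map_add, ← act_mul, ← act_mul,
        ← Matrix.SpecialLinearGroup.coe_mul, ← Matrix.SpecialLinearGroup.coe_mul, M_mul_A_zpow]
    · refine Multiplicative.toAdd.injective ?_
      change -(lvl (g * h)) = -lvl g + -lvl h
      rw [lvl_mul]; ring

theorem phi_elt (m k n : ℤ) : phi (elt m k n) = elt k (-m) (-n) := rfl

/-! ### The finite-dimensional representations -/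

/-- The character `((m, k), n) ↦ (-1) ^ n`. -/
noncomputable def sgn : G →* Circle where
  toFun g := (-1) ^ lvl g
  map_one' := by simp [lvl_one]
  map_mul' g h := by rw [lvl_mul, zpow_add]

/-- The trivial representation. -/
noncomputable def rho1 : UnitaryRep G ℂ := UnitaryRep.ofCharacter 1

/-- The one-dimensional representation `((m, k), n) ↦ (-1) ^ n`. -/
noncomputable def piRep : UnitaryRep G ℂ := UnitaryRep.ofCharacter sgn

/-- The value at `v = (m, k)` of the character `v ↦ exp (2 π i ⟨v, Aᵢ⟩)` of `ℤ²`, where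
`A₁ = (0, 1/2)`, `A₂ = (1/2, 0)`, `A₀ = A₃ = (1/2, 1/2)`. -/
noncomputable def halfChar (i : ZMod 3) (v : Fin 2 → ℤ) : ℂ :=
  (-1) ^ (if i = 1 then v 1 else if i = 2 then v 0 else v 0 + v 1)

theorem halfChar_add (i : ZMod 3) (v w : Fin 2 → ℤ) :
    halfChar i (v + w) = halfChar i v * halfChar i w := by
  unfold halfChar
  rw [← zpow_add₀ (by norm_num)]
  congr 1
  split_ifs <;> simp [add_add_add_comm]

theorem halfChar_A (i : ZMod 3) (v : Fin 2 → ℤ) :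
    halfChar i (act A.1 v) = halfChar (i - 1) v := by
  have h2 : ∀ x : ℤ, ((-1 : ℂ)) ^ (2 * x) = 1 := fun x => by rw [zpow_mul]; norm_num
  have hne : (-1 : ℂ) ≠ 0 := by norm_num
  have e0 : act A.1 v 0 = 2 * v 0 + v 1 := by simp [act, A]
  have e1 : act A.1 v 1 = v 0 + v 1 := by simp [act, A]
  fin_cases i
  · change (-1 : ℂ) ^ (act A.1 v 0 + act A.1 v 1) = (-1) ^ v 0
    rw [e0, e1, show 2 * v 0 + v 1 + (v 0 + v 1) = 2 * (v 0 + v 1) + v 0 by ring,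
      zpow_add₀ hne, h2, one_mul]
  · change (-1 : ℂ) ^ (act A.1 v 1) = (-1) ^ (v 0 + v 1)
    rw [e1]
  · change (-1 : ℂ) ^ (act A.1 v 0) = (-1) ^ v 1
    rw [e0, zpow_add₀ hne, h2, one_mul]

theorem halfChar_zpow (n : ℤ) : ∀ (i : ZMod 3) (v : Fin 2 → ℤ),
    halfChar i (act (A ^ n).1 v) = halfChar (i - n) v := by
  induction n with
  | zero => intro i v; simp [act_one]
  | succ n ih =>
    intro i v
    rw [add_comm, zpow_add, zpow_one, Matrix.SpecialLinearGroup.coe_mul, act_mul, halfChar_A, ih]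
    push_cast
    congr 1; ring
  | pred n ih =>
    intro i v
    have h := halfChar_A (i + 1) (act (A ^ (-(n : ℤ) - 1)).1 v)
    rw [← act_mul, ← Matrix.SpecialLinearGroup.coe_mul, ← zpow_one_add, add_sub_cancel_right,
      show (1 : ℤ) + (-(n : ℤ) - 1) = -n by ring, ih] at h
    rw [← h]
    push_cast
    congr 1; ring

theorem norm_halfChar (i : ZMod 3) (v : Fin 2 → ℤ) : ‖halfChar i v‖ = 1 := by
  rw [halfChar, norm_zpow, norm_neg, norm_one, one_zpow]

/-- The three-dimensional representation attached to the orbit `{A₁, A₂, A₃}`: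
`(ρ₂((m, k), n) f)(i) = χᵢ(m, k) f(i - n)`, so that `((m, k), 0)` multiplies the basis vector
`εᵢ` by `χᵢ(m, k)` and `((0, 0), n)` maps `εᵢ` to `ε_{i + n}`, indices taken mod 3. -/
noncomputable def rho2 : UnitaryRep G (EuclideanSpace ℂ (ZMod 3)) :=
  UnitaryRep.ofIsometries
    (fun g =>
      { toFun := fun f => WithLp.toLp 2 fun i => halfChar i (vec g) * f (i - lvl g)
        map_add' := fun f f' => by ext i; simp [mul_add]
        map_smul' := fun c f => by ext i; simp; ring
        norm_map' := fun f => by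
          simp only [LinearMap.coe_mk, AddHom.coe_mk, EuclideanSpace.norm_eq, norm_mul,
            norm_halfChar, one_mul]
          congr 1
          exact Equiv.sum_comp (Equiv.subRight (lvl g : ZMod 3)) fun j => ‖f j‖ ^ 2 })
    (fun f => by
      ext i
      change halfChar i (vec 1) * f (i - (lvl 1 : ℤ)) = f i
      simp [vec_one, lvl_one, halfChar])
    (fun g h f => by
      ext i
      change halfChar i (vec (g * h)) * f (i - (lvl (g * h) : ℤ)) =
        halfChar i (vec g) * (halfChar (i - lvl g) (vec h) * f (i - lvl g - lvl h))
      rw [vec_mul, halfChar_add, halfChar_zpow, lvl_mul, mul_assoc]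
      push_cast
      rw [sub_sub])

/-- The three-dimensional representation `ρ₂ ⊗ π`. -/
noncomputable def rho2pi : UnitaryRep G (EuclideanSpace ℂ (ZMod 3)) :=
  UnitaryRep.twist rho2 sgn

/-! ### The representation on `L²(𝕋²)` -/

/-- The torus `𝕋² = (ℝ/ℤ)²`. -/
abbrev Torus : Type := UnitAddTorus (Fin 2)

/-- Lebesgue measure on the torus, of total mass one. -/
noncomputable abbrev lebesgue : Measure Torus :=
  Measure.pi fun _ : Fin 2 => AddCircle.haarAddCircle

/-- The Hilbert space `L²(𝕋²)`. -/
abbrev L2Torus : Type := Lp ℂ 2 lebesgue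

theorem continuous_act (B : Matrix (Fin 2) (Fin 2) ℤ) : Continuous (act B : Torus → Torus) := by
  refine continuous_pi fun i => ?_
  change Continuous fun x : Torus => ∑ j, B i j • x j
  exact continuous_finsetSum _ fun j _ => (continuous_apply j).zsmul (B i j)

theorem measurePreserving_act (B : SL(2, ℤ)) :
    MeasurePreserving (act B.1 : Torus → Torus) lebesgue lebesgue := by
  refine AddMonoidHom.measurePreserving (continuous_act B.1) (fun x => ⟨act (B⁻¹).1 x, ?_⟩) rfl
  rw [← act_mul, ← Matrix.SpecialLinearGroup.coe_mul]
  simp [act_one]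

theorem norm_mFourier_apply (v : Fin 2 → ℤ) (x : Torus) : ‖UnitAddTorus.mFourier v x‖ = 1 := by
  simp [UnitAddTorus.mFourier, Circle.norm_coe]

theorem mFourier_act (B : Matrix (Fin 2) (Fin 2) ℤ) (v : Fin 2 → ℤ) (x : Torus) :
    UnitAddTorus.mFourier v (act B x) = UnitAddTorus.mFourier (act B.transpose v) x := by
  simp only [UnitAddTorus.mFourier, act, ContinuousMap.coe_mk, fourier_apply, AddMonoidHom.coe_mk,
    ZeroHom.coe_mk, Fin.prod_univ_two, Fin.sum_univ_two, Matrix.transpose_apply, smul_eq_mul,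
    ← Circle.coe_mul, ← AddCircle.toCircle_add]
  congr 2
  simp only [smul_add, add_smul, mul_smul, smul_comm (v _) (B _ _)]
  abel

theorem memLp_torusOp (B : SL(2, ℤ)) (v : Fin 2 → ℤ) (f : L2Torus) :
    MemLp (fun x => UnitAddTorus.mFourier v x * f (act B.1 x)) 2 lebesgue := by
  have h := (Lp.memLp f).comp_measurePreserving (measurePreserving_act B)
  refine h.congr_norm ((UnitAddTorus.mFourier v).continuous.aestronglyMeasurable.mul h.1) ?_
  filter_upwards with x
  simp [norm_mFourier_apply]

/-- The isometry `(U f)(x) = exp (2 π i ⟨v, x⟩) f (B x)` of `L²(𝕋²)`. -/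
noncomputable def torusOp (B : SL(2, ℤ)) (v : Fin 2 → ℤ) : L2Torus →ₗᵢ[ℂ] L2Torus where
  toFun f := (memLp_torusOp B v f).toLp
  map_add' f g := by
    refine Lp.ext ?_
    filter_upwards [MemLp.coeFn_toLp (memLp_torusOp B v (f + g)),
      MemLp.coeFn_toLp (memLp_torusOp B v f), MemLp.coeFn_toLp (memLp_torusOp B v g),
      Lp.coeFn_add (memLp_torusOp B v f).toLp (memLp_torusOp B v g).toLp,
      (measurePreserving_act B).quasiMeasurePreserving.ae (Lp.coeFn_add f g)] with x h1 h2 h3 h4 h5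
    rw [h1, h4, Pi.add_apply, h2, h3, h5, Pi.add_apply, mul_add]
  map_smul' c f := by
    refine Lp.ext ?_
    filter_upwards [MemLp.coeFn_toLp (memLp_torusOp B v (c • f)),
      MemLp.coeFn_toLp (memLp_torusOp B v f),
      Lp.coeFn_smul c (memLp_torusOp B v f).toLp,
      (measurePreserving_act B).quasiMeasurePreserving.ae (Lp.coeFn_smul c f)] with x h1 h2 h3 h4
    rw [h1, RingHom.id_apply, h3, Pi.smul_apply, h2, h4, Pi.smul_apply, mul_smul_comm]
  norm_map' f := by
    change ‖(memLp_torusOp B v f).toLp‖ = ‖f‖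
    rw [← Lp.norm_compMeasurePreserving f (measurePreserving_act B)]
    rw [Lp.norm_def, Lp.norm_def]
    refine congrArg ENNReal.toReal (eLpNorm_congr_norm_ae ?_)
    filter_upwards [MemLp.coeFn_toLp (memLp_torusOp B v f),
      Lp.coeFn_compMeasurePreserving f (measurePreserving_act B)] with x h1 h2
    rw [h1, h2, norm_mul, norm_mFourier_apply, one_mul, Function.comp_apply]

theorem coeFn_torusOp (B : SL(2, ℤ)) (v : Fin 2 → ℤ) (f : L2Torus) :
    torusOp B v f =ᵐ[lebesgue] fun x => UnitAddTorus.mFourier v x * f (act B.1 x) :=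
  MemLp.coeFn_toLp (memLp_torusOp B v f)

theorem A_zpow_transpose (n : ℤ) : (A ^ n).1.transpose = (A ^ n).1 := by
  have hA : A.1.transpose = A.1 := by decide
  have hAi : (A⁻¹).1.transpose = (A⁻¹).1 := by decide
  induction n with
  | zero => simp
  | succ n ih =>
    rw [zpow_add_one, Matrix.SpecialLinearGroup.coe_mul, Matrix.transpose_mul, ih, hA,
      ← Matrix.SpecialLinearGroup.coe_mul, ← Matrix.SpecialLinearGroup.coe_mul,
      ← zpow_one_add, ← zpow_add_one, add_comm]
  | pred n ih =>
    rw [zpow_sub_one, Matrix.SpecialLinearGroup.coe_mul, Matrix.transpose_mul, ih, hAi,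
      ← Matrix.SpecialLinearGroup.coe_mul, ← Matrix.SpecialLinearGroup.coe_mul,
      (Commute.inv_left (Commute.self_zpow A _)).eq]

/-- The representation of `G` on `L²(𝕋²)` given by
`(ρ((m, k), n) f)(x) = exp (2 π i ⟨(m, k), x⟩) f (Aⁿ x)`. -/
noncomputable def rhoTorus : UnitaryRep G L2Torus :=
  UnitaryRep.ofIsometries (fun g => torusOp (A ^ lvl g) (vec g))
    (fun f => by
      refine Lp.ext ?_
      filter_upwards [coeFn_torusOp (A ^ lvl 1) (vec 1) f] with x h
      rw [h, vec_one, lvl_one, zpow_zero, UnitAddTorus.mFourier_zero]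
      simp [act_one])
    (fun g h f => by
      refine Lp.ext ?_
      filter_upwards [coeFn_torusOp (A ^ lvl (g * h)) (vec (g * h)) f,
        coeFn_torusOp (A ^ lvl g) (vec g) (torusOp (A ^ lvl h) (vec h) f),
        (measurePreserving_act (A ^ lvl g)).quasiMeasurePreserving.ae
          (coeFn_torusOp (A ^ lvl h) (vec h) f)] with x h1 h2 h3
      rw [h1, h2, h3, vec_mul, lvl_mul, UnitAddTorus.mFourier_add, mFourier_act, A_zpow_transpose,
        ← act_mul, ← Matrix.SpecialLinearGroup.coe_mul, ← zpow_add, mul_assoc,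
        add_comm (lvl h)])

end Anosov

/-! Let `M` be the matrix of `phi` on ℤ². The relations M Aⁿ = A⁻ⁿ M and M² = -1 drive the argument,
together with the three nontrivial characters of ℤ² of order two, on whose indices A acts as a
rotation mod 3 and `M` as negation.

Twisted conjugation changes the level n by an even number, so n can be reduced to 0 or 1.
Translations then shift the vector by the image of 1 - AⁿM, which has index 2 in ℤ² and is the
kernel of an order-two character. Parity of the level and the value of that character form a
complete invariant with four values.

In a finite-dimensional irreducible representation the translations have a common eigenvector, with
some character χ, and its shifts span the space. If the class is fixed, the intertwiner carries χ to
χ ∘ M, which must lie in the A-orbit of χ. Thus χ is invariant under some AʳM, whose square is -1,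
and so χ² = 1. The orbit of χ has length k = 1 or 3, and the element (0, k) acts by a scalar z. As
`phi` inverts this element, z = z⁻¹. Two orbits and two signs give the four representations
(`exists_char_M_eq`, `char_mul_self`, `exists_eigenvector_sh`, `equivalent_of_halfChar`).

On L²(𝕋²) the group permutes the Fourier basis, e_w ↦ e_{v + Aⁿw}. A nonzero w has an infinite
A-orbit, so square summability leaves only multiples of e₀ fixed by the shifts. Hence a projection
commuting with the action is scalar, and the representation is irreducible. Composition with `M`
intertwines it with its twist by `phi`, which gives a fifth fixed point. -/

namespace Anosov

/-! ### Generators of the group -/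

/-- The translation `(v, 0)`. -/
def tr (v : Fin 2 → ℤ) : G := ⟨Multiplicative.ofAdd v, Multiplicative.ofAdd 0⟩

/-- The element `(0, n)`. -/
def sh (n : ℤ) : G := ⟨Multiplicative.ofAdd 0, Multiplicative.ofAdd n⟩

@[simp] theorem vec_tr (v : Fin 2 → ℤ) : vec (tr v) = v := rfl

@[simp] theorem lvl_tr (v : Fin 2 → ℤ) : lvl (tr v) = 0 := rfl

@[simp] theorem vec_sh (n : ℤ) : vec (sh n) = 0 := rfl

@[simp] theorem lvl_sh (n : ℤ) : lvl (sh n) = n := rfl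

theorem ext_vec_lvl {g h : G} (h₁ : vec g = vec h) (h₂ : lvl g = lvl h) : g = h :=
  SemidirectProduct.ext (Multiplicative.toAdd.injective h₁) (Multiplicative.toAdd.injective h₂)

theorem eq_tr_mul_sh (g : G) : g = tr (vec g) * sh (lvl g) :=
  ext_vec_lvl (by simp [vec_mul]) (by simp [lvl_mul])

theorem tr_zero : tr 0 = 1 := rfl

theorem sh_zero : sh 0 = 1 := rfl

theorem tr_add (v w : Fin 2 → ℤ) : tr (v + w) = tr v * tr w :=
  ext_vec_lvl (by simp [vec_mul, act_one]) (by simp [lvl_mul])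

theorem sh_add (m n : ℤ) : sh (m + n) = sh m * sh n :=
  ext_vec_lvl (by simp [vec_mul]) (by simp [lvl_mul])

theorem sh_mul_tr (n : ℤ) (v : Fin 2 → ℤ) : sh n * tr v = tr (act (A ^ n).1 v) * sh n :=
  ext_vec_lvl (by simp [vec_mul]) (by simp [lvl_mul])

theorem tr_mul_sh (n : ℤ) (v : Fin 2 → ℤ) : tr v * sh n = sh n * tr (act (A ^ (-n)).1 v) := by
  rw [sh_mul_tr, ← act_mul, ← Matrix.SpecialLinearGroup.coe_mul, ← zpow_add]
  simp [act_one]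

theorem act_M (v : Fin 2 → ℤ) : act M.1 v = ![v 1, -v 0] := by
  ext i; fin_cases i <;> simp [act, M]

theorem vec_phi (g : G) : vec (phi g) = act M.1 (vec g) := (act_M (vec g)).symm

theorem lvl_phi (g : G) : lvl (phi g) = -lvl g := rfl

theorem phi_tr (v : Fin 2 → ℤ) : phi (tr v) = tr (act M.1 v) :=
  ext_vec_lvl (by rw [vec_phi]; rfl) (by simp [lvl_phi])

theorem phi_sh (n : ℤ) : phi (sh n) = sh (-n) :=
  ext_vec_lvl (by rw [vec_phi]; simp) (by simp [lvl_phi])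

/-! ### The characters of order two -/

theorem halfChar_zero (i : ZMod 3) : halfChar i 0 = 1 := by
  simp [halfChar]

theorem halfChar_mul_self (i : ZMod 3) (v : Fin 2 → ℤ) : halfChar i v * halfChar i v = 1 := by
  have h2 : ∀ x : ℤ, (-1 : ℂ) ^ x * (-1) ^ x = 1 := fun x => by
    rw [← mul_zpow]; simp
  exact h2 _

theorem neg_one_zpow_add_neg (a b : ℤ) : (-1 : ℂ) ^ (a + -b) = (-1) ^ (a + b) := by
  have : (-1 : ℂ) ≠ 0 := by norm_num
  rw [zpow_add₀ this, zpow_add₀ this, zpow_neg, ← inv_zpow]; norm_num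

/-- Modulo 2, `M` swaps the two coordinates: it exchanges the characters 1 and 2 and fixes their
product, character 0. -/
theorem halfChar_M (i : ZMod 3) (v : Fin 2 → ℤ) : halfChar i (act M.1 v) = halfChar (-i) v := by
  rw [act_M]
  have hs := neg_one_zpow_add_neg 0 (v 0)
  simp only [zero_add] at hs
  fin_cases i
  · change (-1 : ℂ) ^ (v 1 + -v 0) = (-1) ^ (v 0 + v 1)
    rw [neg_one_zpow_add_neg, add_comm]
  · exact hs
  · rfl

/-! ### The Reidemeister number -/

theorem twisted_vec (g x : G) : vec (g * x * phi g⁻¹) =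
    vec g + act (A ^ lvl g).1 (vec x) - act (A ^ (lvl x + 2 * lvl g)).1 (act M.1 (vec g)) := by
  have h1 : vec g⁻¹ = - act (A ^ (-lvl g)).1 (vec g) := by
    have h := vec_mul g⁻¹ g
    have hl := lvl_mul g⁻¹ g
    rw [inv_mul_cancel] at h hl
    rw [lvl_one] at hl
    rw [vec_one, show lvl g⁻¹ = -lvl g by omega] at h
    exact eq_neg_of_add_eq_zero_left h.symm
  have h2 : act M.1 (act (A ^ (-lvl g)).1 (vec g)) = act (A ^ lvl g).1 (act M.1 (vec g)) := by
    rw [← act_mul, ← act_mul, ← Matrix.SpecialLinearGroup.coe_mul,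
      ← Matrix.SpecialLinearGroup.coe_mul, M_mul_A_zpow, neg_neg]
  rw [vec_mul, vec_mul, vec_phi, h1, map_neg, map_neg, h2, ← act_mul,
    ← Matrix.SpecialLinearGroup.coe_mul, ← zpow_add, lvl_mul, sub_eq_add_neg,
    show lvl g + lvl x + lvl g = lvl x + 2 * lvl g by ring]

/-- Because `phi` negates levels, both outer factors contribute `lvl g`; only the parity of the
level survives. -/
theorem twisted_lvl (g x : G) : lvl (g * x * phi g⁻¹) = lvl x + 2 * lvl g := by
  have hl := lvl_mul g⁻¹ g
  rw [inv_mul_cancel, lvl_one] at hl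
  rw [lvl_mul, lvl_mul, lvl_phi]
  omega

/-- The sign attached to an element, which is constant on twisted conjugacy classes. -/
noncomputable def twistedSign (x : G) : ℂ := halfChar (-lvl x) (vec x)

theorem halfChar_sub (i : ZMod 3) (v w : Fin 2 → ℤ) :
    halfChar i (v - w) = halfChar i v * halfChar i w := by
  have h := halfChar_add i (v - w) w
  rw [sub_add_cancel] at h
  rw [h, mul_assoc, halfChar_mul_self, mul_one]

/-- Modulo 3 the indices collapse: the two terms in `vec g` get the same character, so their product
is a square and equals 1, while the index on `vec x` returns to `-lvl x` because 3 `lvl g` vanishes.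
-/
theorem twistedSign_twisted (g x : G) : twistedSign (g * x * phi g⁻¹) = twistedSign x := by
  have h3 : (3 : ZMod 3) = 0 := rfl
  unfold twistedSign
  rw [twisted_vec, twisted_lvl, halfChar_sub, halfChar_add, halfChar_zpow, halfChar_zpow,
    halfChar_M]
  push_cast
  rw [show (-((lvl x : ZMod 3) + 2 * lvl g) - lvl g) = -lvl x by linear_combination -lvl g * h3,
    show -(-((lvl x : ZMod 3) + 2 * lvl g) - (lvl x + 2 * lvl g)) = -(lvl x + 2 * lvl g) by
      linear_combination (lvl x + 2 * lvl g) * h3,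
    mul_right_comm, halfChar_mul_self, one_mul]

theorem exists_twisted_small (x : G) :
    ∃ g : G, (lvl (g * x * phi g⁻¹) = 0 ∨ lvl (g * x * phi g⁻¹) = 1) ∧
      lvl (g * x * phi g⁻¹) = lvl x % 2 := by
  refine ⟨sh (-(lvl x / 2)), ?_⟩
  rw [twisted_lvl, lvl_sh]
  omega

/-- Translations suffice: they keep the level n and move the vector by the image of 1 - AⁿM. For n =
0 this is the lattice of even coordinate sum, for n = 1 that of even first coordinate, exactly the
kernels of the characters in `twistedSign`. -/
theorem twisted_of_lvl_eq {x y : G} (h : lvl x = lvl y) (hl : lvl x = 0 ∨ lvl x = 1)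
    (hs : twistedSign x = twistedSign y) : ∃ g : G, y = g * x * phi g⁻¹ := by
  have key : ∀ a b : ℤ, (-1 : ℂ) ^ a = (-1) ^ b → ∃ c, b = a + 2 * c := by
    intro a b hab
    have : (-1 : ℂ) ^ (b - a) = 1 := by
      rw [zpow_sub₀ (by norm_num), hab, div_self (zpow_ne_zero _ (by norm_num))]
    rcases Int.even_or_odd (b - a) with he | ho
    · obtain ⟨c, hc⟩ := he
      exact ⟨c, by omega⟩
    · rw [ho.neg_one_zpow] at this
      norm_num at this
  unfold twistedSign at hs
  rw [← h] at hs
  rcases hl with hl | hl <;> rw [hl] at hs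
  · obtain ⟨c, hc⟩ := key (vec x 0 + vec x 1) (vec y 0 + vec y 1) hs
    -- Solves (a - b, a + b) = `vec y - vec x`, where (a - b, a + b) is (1 - M)(a, b).
    refine ⟨tr ![c, c - (vec y 0 - vec x 0)], ext_vec_lvl ?_ ?_⟩
    · rw [twisted_vec, lvl_tr, hl, act_M]
      ext i; fin_cases i
      · simp [act_one, Matrix.vecHead]
      · simp [act_one, Matrix.vecHead, Matrix.vecTail]
        linarith
    · rw [twisted_lvl, h, lvl_tr]; ring
  · obtain ⟨c, hc⟩ := key (vec x 0) (vec y 0) hs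
    -- Solves (2a - 2b, a) = `vec y - vec x`, where (2a - 2b, a) is (1 - AM)(a, b).
    refine ⟨tr ![vec y 1 - vec x 1, vec y 1 - vec x 1 - c], ext_vec_lvl ?_ ?_⟩
    · rw [twisted_vec, lvl_tr, hl, act_M]
      ext i; fin_cases i
      · simp [act_one, Matrix.vecHead, Matrix.vecTail]
        simp [act, A]
        linarith
      · simp [act_one, Matrix.vecHead, Matrix.vecTail]
        simp [act, A]
    · rw [twisted_lvl, h, lvl_tr]; ring

theorem halfChar_eq_one_or_neg_one (i : ZMod 3) (v : Fin 2 → ℤ) :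
    halfChar i v = 1 ∨ halfChar i v = -1 :=
  mul_self_eq_one_iff.mp (halfChar_mul_self i v)

/-- The complete invariant of twisted conjugacy. -/
noncomputable def twistedInvariant :
    Quotient (twistedConjSetoid phi.toMonoidHom) → Prop × Prop :=
  Quotient.lift (fun x => (twistedSign x = 1, Even (lvl x))) (by
    rintro x _ ⟨g, rfl⟩
    change _ = (twistedSign (g * x * phi g⁻¹) = 1, Even (lvl (g * x * phi g⁻¹)))
    rw [twistedSign_twisted, twisted_lvl]
    simp [Int.even_add])

theorem twistedInvariant_injective : Function.Injective twistedInvariant := by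
  intro a b
  induction a using Quotient.inductionOn with | _ x => ?_
  induction b using Quotient.inductionOn with | _ y => ?_
  intro hxy
  obtain ⟨g, hg, hg'⟩ := exists_twisted_small x
  obtain ⟨k, hk, hk'⟩ := exists_twisted_small y
  have hs : (twistedSign x = 1) = (twistedSign y = 1) := congrArg Prod.fst hxy
  have hl : Even (lvl x) = Even (lvl y) := congrArg Prod.snd hxy
  have hlvl : lvl (g * x * phi g⁻¹) = lvl (k * y * phi k⁻¹) := by
    rw [hg', hk']
    rw [Int.even_iff, Int.even_iff, eq_iff_iff] at hl
    omega
  have hsign : twistedSign (g * x * phi g⁻¹) = twistedSign (k * y * phi k⁻¹) := by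
    rw [twistedSign_twisted, twistedSign_twisted]
    -- The signs are ±1, so knowing whether each equals 1 determines them.
    rcases halfChar_eq_one_or_neg_one (-lvl x) (vec x) with h | h <;>
    rcases halfChar_eq_one_or_neg_one (-lvl y) (vec y) with h' | h' <;>
    simp only [twistedSign, h, h'] at hs ⊢ <;> norm_num at hs
  let s := twistedConjSetoid phi.toMonoidHom
  refine Quotient.sound (s := s) ?_
  have h1 : s.r x (g * x * phi g⁻¹) := ⟨g, rfl⟩
  have h2 : s.r y (k * y * phi k⁻¹) := ⟨k, rfl⟩
  exact s.trans' h1 (s.trans' (twisted_of_lvl_eq hlvl hg hsign) (s.symm' h2))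

theorem twistedInvariant_surjective : Function.Surjective twistedInvariant := by
  rintro ⟨p, q⟩
  have h0 : ∀ v n, twistedSign (tr v * sh n) = halfChar (-n) v := fun v n => by
    simp [twistedSign, vec_mul, lvl_mul]
  have h1 : ∀ v n, lvl (tr v * sh n) = n := fun v n => by simp [lvl_mul]
  have key : ∀ v n, twistedInvariant (Quotient.mk _ (tr v * sh n)) =
      (halfChar (-n) v = 1, Even n) := fun v n => by
    have h := congrArg Even (h1 v n)
    rw [← h0, ← h]; rfl
  have e : (-1 : ℂ) ≠ 1 := by norm_num
  have a : halfChar 0 ![1, 0] = -1 := by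
    change (-1 : ℂ) ^ ((1 : ℤ) + 0) = -1
    norm_num
  have b : halfChar (-1) ![1, 0] = -1 := by
    change (-1 : ℂ) ^ (1 : ℤ) = -1
    norm_num
  by_cases hp : p <;> by_cases hq : q <;> simp only [hp, hq]
  · exact ⟨_, (key 0 0).trans (by simp [halfChar_zero])⟩
  · exact ⟨_, (key 0 1).trans (by simp [halfChar_zero])⟩
  · exact ⟨_, (key ![1, 0] 0).trans (by simp [a, e])⟩
  · exact ⟨_, (key ![1, 0] 1).trans (by simp [b, e])⟩

theorem reidemeisterNumber_phi : reidemeisterNumber phi.toMonoidHom = 4 := by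
  rw [reidemeisterNumber, ENat.card_congr
    (Equiv.ofBijective _ ⟨twistedInvariant_injective, twistedInvariant_surjective⟩),
    ENat.card_eq_coe_fintype_card]
  simp

end Anosov

/-! ### General facts on unitary representations -/

namespace UnitaryRep

variable {G : Type*} [Group G]
variable {H : Type*} [NormedAddCommGroup H] [InnerProductSpace ℂ H]

theorem ofCharacter_apply (χ : G →* Circle) (g : G) (z : ℂ) :
    ofCharacter χ g z = (χ g : ℂ) * z := rfl

theorem twist_apply (ρ : UnitaryRep G H) (χ : G →* Circle) (g : G) (v : H) :
    twist ρ χ g v = (χ g : ℂ) • ρ g v := rfl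

theorem mul_apply (ρ : UnitaryRep G H) (g h : G) (v : H) : ρ (g * h) v = ρ g (ρ h v) := by
  rw [map_mul]; rfl

theorem one_apply (ρ : UnitaryRep G H) (v : H) : ρ 1 v = v := by
  rw [map_one]; rfl

theorem isIrreducible_ofCharacter (χ : G →* Circle) : IsIrreducible (ofCharacter χ) :=
  ⟨inferInstance, fun W _ _ => eq_bot_or_eq_top (α := Ideal ℂ) W⟩

theorem IsIrreducible.twist {ρ : UnitaryRep G H} (h : IsIrreducible ρ) (χ : G →* Circle) :
    IsIrreducible (UnitaryRep.twist ρ χ) := by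
  refine ⟨h.1, fun W hW hinv => h.2 W hW fun g v hv => ?_⟩
  have h1 := W.smul_mem (χ g : ℂ)⁻¹ (hinv g v hv)
  rwa [twist_apply, inv_smul_smul₀ (Circle.coe_ne_zero _)] at h1

theorem eq_top_of_mem {ρ : UnitaryRep G H} [FiniteDimensional ℂ H] (h : IsIrreducible ρ)
    (W : Submodule ℂ H) (hinv : ∀ g : G, ∀ v ∈ W, ρ g v ∈ W) {u : H} (hu : u ∈ W) (hu0 : u ≠ 0) :
    W = ⊤ :=
  (h.2 W W.closed_of_finiteDimensional hinv).resolve_left fun hW =>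
    hu0 ((Submodule.eq_bot_iff W).mp hW u hu)

end UnitaryRep

theorem UnitaryDual.mk_mem_fix {G : Type} [Group G] {H : Type} [NormedAddCommGroup H]
    [InnerProductSpace ℂ H] [CompleteSpace H] {ρ : UnitaryRep G H}
    (h : UnitaryRep.IsIrreducible ρ) {φ : G ≃* G} :
    UnitaryDual.mk ρ h ∈ UnitaryDual.fix φ ↔
      ∃ S : H ≃ₗᵢ[ℂ] H, ∀ g v, S (ρ (φ g) v) = ρ g (S v) :=
  ⟨fun hf => Quotient.exact hf, fun hS => Quotient.sound hS⟩

theorem UnitaryDual.mk_eq_mk {G : Type} [Group G] {H K : Type} [NormedAddCommGroup H]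
    [InnerProductSpace ℂ H] [CompleteSpace H] [NormedAddCommGroup K]
    [InnerProductSpace ℂ K] [CompleteSpace K] {ρ : UnitaryRep G H} {σ : UnitaryRep G K}
    (h : UnitaryRep.IsIrreducible ρ) (k : UnitaryRep.IsIrreducible σ) :
    UnitaryDual.mk ρ h = UnitaryDual.mk σ k ↔ UnitaryRep.Equivalent ρ σ :=
  ⟨fun hf => Quotient.exact hf, fun hS => Quotient.sound hS⟩

namespace Anosov

/-! ### The four finite-dimensional representations -/

theorem rho2_apply (g : G) (f : EuclideanSpace ℂ (ZMod 3)) (i : ZMod 3) :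
    rho2 g f i = halfChar i (vec g) * f (i - lvl g) := rfl

theorem sgn_apply (g : G) : (sgn g : ℂ) = (-1) ^ lvl g := by
  change (((-1 : Circle) ^ lvl g : Circle) : ℂ) = _
  simp

theorem sgn_phi (g : G) : (sgn (phi g) : ℂ) = sgn g := by
  rw [sgn_apply, sgn_apply, lvl_phi, zpow_neg, ← inv_zpow]; norm_num

theorem irreducible_rho1 : UnitaryRep.IsIrreducible rho1 :=
  UnitaryRep.isIrreducible_ofCharacter _

theorem irreducible_piRep : UnitaryRep.IsIrreducible piRep :=
  UnitaryRep.isIrreducible_ofCharacter _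

theorem rho2_tr (v : Fin 2 → ℤ) (f : EuclideanSpace ℂ (ZMod 3)) (i : ZMod 3) :
    rho2 (tr v) f i = halfChar i v * f i := by
  simp [rho2_apply]

theorem rho2_sh (n : ℤ) (f : EuclideanSpace ℂ (ZMod 3)) (i : ZMod 3) :
    rho2 (sh n) f i = f (i - n) := by
  simp [rho2_apply, halfChar_zero]

/-- The translations separate the coordinate lines and the shifts permute them transitively, so a
nonzero invariant subspace contains every basis vector. -/
theorem irreducible_rho2 : UnitaryRep.IsIrreducible rho2 := by
  refine ⟨inferInstance, fun W _ hinv => or_iff_not_imp_left.mpr fun hW => ?_⟩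
  obtain ⟨f, hf, hf0⟩ := W.exists_mem_ne_zero_of_ne_bot hW
  obtain ⟨i, hi⟩ : ∃ i, f i ≠ 0 := by
    by_contra! h
    exact hf0 (by ext i; exact h i)
  have cast_val : ∀ j : ZMod 3, ((j.val : ℤ) : ZMod 3) = j := fun j => by simp
  obtain ⟨f', hf', h1⟩ : ∃ f' ∈ W, f' 1 ≠ 0 :=
    ⟨_, hinv (sh ((1 - i).val : ℤ)) f hf, by rw [rho2_sh, cast_val]; simpa using hi⟩
  have he1 : EuclideanSpace.single (1 : ZMod 3) (1 : ℂ) ∈ W := by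
    -- The vector (1, 0) acts by +1 on coordinate 1 and by -1 on the other two, so adding the
    -- translate isolates coordinate 1.
    have h2 := W.smul_mem (2 * f' 1)⁻¹ (W.add_mem hf' (hinv (tr ![1, 0]) f' hf'))
    convert h2 using 1
    ext j
    have a0 : halfChar 0 ![1, 0] = -1 := by
      change (-1 : ℂ) ^ ((1 : ℤ) + 0) = -1
      norm_num
    have a1 : halfChar 1 ![1, 0] = 1 := by
      change (-1 : ℂ) ^ (0 : ℤ) = 1
      norm_num
    have a2 : halfChar 2 ![1, 0] = -1 := by
      change (-1 : ℂ) ^ (1 : ℤ) = -1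
      norm_num
    rw [PiLp.smul_apply, PiLp.add_apply, rho2_tr]
    fin_cases j
    · change _ = (2 * f' 1)⁻¹ * (f' 0 + halfChar 0 ![1, 0] * f' 0)
      rw [a0]
      simp only [EuclideanSpace.single, neg_mul, one_mul, add_neg_cancel, mul_zero]
      exact Pi.single_eq_of_ne (show (0 : ZMod 3) ≠ 1 by decide) (1 : ℂ)
    · change _ = (2 * f' 1)⁻¹ * (f' 1 + halfChar 1 ![1, 0] * f' 1)
      rw [a1]
      field_simp
      norm_num
      exact Pi.single_eq_same _ _
    · change _ = (2 * f' 1)⁻¹ * (f' 2 + halfChar 2 ![1, 0] * f' 2)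
      rw [a2]
      simp only [EuclideanSpace.single, neg_mul, one_mul, add_neg_cancel, mul_zero]
      exact Pi.single_eq_of_ne (show (2 : ZMod 3) ≠ 1 by decide) (1 : ℂ)
  have he : ∀ j : ZMod 3, EuclideanSpace.single j (1 : ℂ) ∈ W := fun j => by
    have h2 := hinv (sh ((j - 1).val : ℤ)) _ he1
    convert h2 using 1
    ext k
    rw [rho2_sh, cast_val]
    simp [sub_eq_iff_eq_add]
  rw [eq_top_iff, ← (EuclideanSpace.basisFun (ZMod 3) ℂ).toBasis.span_eq, Submodule.span_le]
  rintro _ ⟨j, rfl⟩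
  simpa using he j

theorem irreducible_rho2pi : UnitaryRep.IsIrreducible rho2pi :=
  irreducible_rho2.twist sgn

theorem rho1_mem_fix : UnitaryDual.mk rho1 irreducible_rho1 ∈ UnitaryDual.fix phi :=
  (UnitaryDual.mk_mem_fix _).mpr ⟨LinearIsometryEquiv.refl ℂ ℂ, fun _ _ => rfl⟩

theorem piRep_mem_fix : UnitaryDual.mk piRep irreducible_piRep ∈ UnitaryDual.fix phi :=
  (UnitaryDual.mk_mem_fix _).mpr ⟨LinearIsometryEquiv.refl ℂ ℂ, fun g v => by
    change (sgn (phi g) : ℂ) * v = sgn g * v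
    rw [sgn_phi]⟩

theorem rho2_intertwine (g : G) (f : EuclideanSpace ℂ (ZMod 3)) :
    LinearIsometryEquiv.piLpCongrLeft 2 ℂ ℂ (Equiv.neg (ZMod 3)) (rho2 (phi g) f) =
      rho2 g (LinearIsometryEquiv.piLpCongrLeft 2 ℂ ℂ (Equiv.neg (ZMod 3)) f) := by
  ext i
  change halfChar (-i) (vec (phi g)) * f (-i - lvl (phi g)) =
    halfChar i (vec g) * f (-(i - lvl g))
  have e : -i - ((-lvl g : ℤ) : ZMod 3) = -(i - lvl g) := by push_cast; ring
  rw [vec_phi, halfChar_M, lvl_phi, neg_neg, e]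

theorem rho2_mem_fix : UnitaryDual.mk rho2 irreducible_rho2 ∈ UnitaryDual.fix phi :=
  (UnitaryDual.mk_mem_fix _).mpr ⟨_, rho2_intertwine⟩

theorem rho2pi_mem_fix : UnitaryDual.mk rho2pi irreducible_rho2pi ∈ UnitaryDual.fix phi :=
  (UnitaryDual.mk_mem_fix _).mpr ⟨LinearIsometryEquiv.piLpCongrLeft 2 ℂ ℂ (Equiv.neg (ZMod 3)), fun g f => by
    rw [rho2pi, UnitaryRep.twist_apply, UnitaryRep.twist_apply, sgn_phi, map_smul,
      rho2_intertwine]⟩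

/-! ### Pairwise inequivalence of the four representations -/

theorem not_equivalent_of_finrank_ne {H K : Type} [NormedAddCommGroup H]
    [InnerProductSpace ℂ H] [NormedAddCommGroup K] [InnerProductSpace ℂ K]
    {ρ : UnitaryRep G H} {σ : UnitaryRep G K}
    (h : Module.finrank ℂ H ≠ Module.finrank ℂ K) : ¬ UnitaryRep.Equivalent ρ σ := by
  rintro ⟨S, -⟩
  exact h S.toLinearEquiv.finrank_eq

theorem not_equivalent_rho1_piRep : ¬ UnitaryRep.Equivalent rho1 piRep := by
  rintro ⟨S, hS⟩
  have h := hS (sh 1) 1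
  rw [rho1, piRep, UnitaryRep.ofCharacter_apply, UnitaryRep.ofCharacter_apply, sgn_apply] at h
  simp only [MonoidHom.one_apply, Circle.coe_one, mul_one, lvl_sh, zpow_one, neg_mul,
    one_mul] at h
  simpa using self_eq_neg.mp h

theorem rho2_sh_three (f : EuclideanSpace ℂ (ZMod 3)) : rho2 (sh 3) f = f := by
  ext i
  rw [rho2_sh, show ((3 : ℤ) : ZMod 3) = 0 from rfl, sub_zero]

/-- The element (0, 3) acts as 1 in `rho2` and as -1 in `rho2pi`. -/
theorem not_equivalent_rho2_rho2pi : ¬ UnitaryRep.Equivalent rho2 rho2pi := by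
  rintro ⟨S, hS⟩
  have h := hS (sh 3) (EuclideanSpace.single 0 1)
  rw [rho2pi, UnitaryRep.twist_apply, rho2_sh_three, rho2_sh_three, sgn_apply, lvl_sh,
    show (-1 : ℂ) ^ (3 : ℤ) = -1 by norm_num, neg_one_smul, ← add_eq_zero_iff_eq_neg, ← two_smul ℂ] at h
  simp at h

theorem encard_mk_eq_four :
    ({UnitaryDual.mk rho1 irreducible_rho1, UnitaryDual.mk piRep irreducible_piRep,
      UnitaryDual.mk rho2 irreducible_rho2, UnitaryDual.mk rho2pi irreducible_rho2pi} :
      Set (UnitaryDual G)).encard = 4 := by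
  have h : Module.finrank ℂ ℂ ≠ Module.finrank ℂ (EuclideanSpace ℂ (ZMod 3)) := by simp
  rw [Set.encard_insert_of_notMem, Set.encard_insert_of_notMem, Set.encard_pair]
  · norm_num
  · rw [Ne, UnitaryDual.mk_eq_mk]
    exact not_equivalent_rho2_rho2pi
  · rintro (h' | h') <;>
    exact not_equivalent_of_finrank_ne h ((UnitaryDual.mk_eq_mk _ _).mp h')
  · rintro (h' | h' | h')
    · exact not_equivalent_rho1_piRep ((UnitaryDual.mk_eq_mk _ _).mp h')
    all_goals exact not_equivalent_of_finrank_ne h ((UnitaryDual.mk_eq_mk _ _).mp h')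

theorem mk_mem_finiteDimensional {H : Type} [NormedAddCommGroup H]
    [InnerProductSpace ℂ H] [CompleteSpace H] {ρ : UnitaryRep G H}
    (h : UnitaryRep.IsIrreducible ρ) :
    UnitaryDual.mk ρ h ∈ UnitaryDual.finiteDimensional G ↔ FiniteDimensional ℂ H := by
  constructor
  · rintro ⟨σ, hσ, hσρ⟩
    obtain ⟨S, -⟩ := Quotient.exact hσρ
    exact S.toLinearEquiv.finiteDimensional
  · exact fun hf => ⟨⟨H, ρ, h⟩, hf, rfl⟩

/-! ### Finite-dimensional fixed points -/

open UnitaryRep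

theorem exists_eigenvector_mem {H : Type*} [AddCommGroup H] [Module ℂ H] [FiniteDimensional ℂ H]
    (T : H →ₗ[ℂ] H) {W : Submodule ℂ H} (hT : ∀ w ∈ W, T w ∈ W) (hW : W ≠ ⊥) :
    ∃ w ∈ W, w ≠ 0 ∧ ∃ c : ℂ, T w = c • w := by
  have : Nontrivial W := Submodule.nontrivial_iff_ne_bot.mpr hW
  obtain ⟨c, hc⟩ := Module.End.exists_eigenvalue (T.restrict hT)
  obtain ⟨w, hw⟩ := hc.exists_hasEigenvector
  exact ⟨w, w.2, fun h => hw.2 (Subtype.ext h), c, congrArg Subtype.val hw.apply_eq_smul⟩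

section

variable {H : Type} [NormedAddCommGroup H] [InnerProductSpace ℂ H] {ρ : UnitaryRep G H}

/-- The vectors on which the translations act through `χ`. -/
def charSpace (ρ : UnitaryRep G H) (χ : (Fin 2 → ℤ) → ℂ) : Submodule ℂ H where
  carrier := {x | ∀ v, ρ (tr v) x = χ v • x}
  zero_mem' := by simp
  add_mem' hx hy v := by rw [map_add, hx v, hy v, smul_add]
  smul_mem' c x hx v := by rw [map_smul, hx v, smul_comm]

variable {χ ψ : (Fin 2 → ℤ) → ℂ} {u w : H}

theorem char_add (hu : u ∈ charSpace ρ χ) (hu0 : u ≠ 0) (v v' : Fin 2 → ℤ) :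
    χ (v + v') = χ v * χ v' := by
  have h := hu (v + v')
  rw [tr_add, mul_apply, hu v', map_smul, hu v, smul_smul] at h
  rw [← smul_left_injective ℂ hu0 h, mul_comm]

theorem char_zero (hu : u ∈ charSpace ρ χ) (hu0 : u ≠ 0) : χ 0 = 1 := by
  have h := hu 0
  rw [tr_zero, one_apply] at h
  exact smul_left_injective ℂ hu0 (by simpa using h.symm)

theorem norm_char (hu : u ∈ charSpace ρ χ) (hu0 : u ≠ 0) (v : Fin 2 → ℤ) : ‖χ v‖ = 1 := by
  have h := congrArg norm (hu v)
  rw [LinearIsometryEquiv.norm_map, norm_smul] at h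
  exact (mul_eq_right₀ (norm_ne_zero_iff.mpr hu0)).mp h.symm

theorem inner_eq_zero_of_char_ne (hu : u ∈ charSpace ρ χ) (hw : w ∈ charSpace ρ ψ)
    (h : χ ≠ ψ) : inner ℂ u w = 0 := by
  by_cases hu0 : u = 0
  · simp [hu0]
  obtain ⟨v, hv⟩ := Function.ne_iff.mp h
  have h1 := (ρ (tr v)).inner_map_map u w
  rw [hu v, hw v, inner_smul_left, inner_smul_right, ← mul_assoc] at h1
  by_contra h0
  have h2 := (mul_eq_right₀ h0).mp h1
  have h3 : (starRingEnd ℂ) (χ v) * χ v = 1 := by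
    rw [Complex.conj_mul', norm_char hu hu0]; simp
  have h4 : (starRingEnd ℂ) (χ v) ≠ 0 := left_ne_zero_of_mul_eq_one h3
  exact hv (mul_left_cancel₀ h4 (h3.trans h2.symm))

theorem sh_mem_charSpace (hu : u ∈ charSpace ρ χ) (n : ℤ) :
    ρ (sh n) u ∈ charSpace ρ (fun v => χ (act (A ^ (-n)).1 v)) := fun v => by
  rw [← mul_apply, tr_mul_sh, mul_apply, hu, map_smul]

/-- Each shift of `u` is again a common eigenvector of the translations, so the span of the shifts
is invariant under the whole group. -/
theorem span_orbit_eq_top [FiniteDimensional ℂ H] (hρ : IsIrreducible ρ)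
    (hu : u ∈ charSpace ρ χ) (hu0 : u ≠ 0) :
    Submodule.span ℂ (Set.range fun n : ℤ => ρ (sh n) u) = ⊤ := by
  refine eq_top_of_mem hρ _ (fun g v hv => ?_) (Submodule.subset_span ⟨0, rfl⟩)
    (by simpa [sh_zero, one_apply] using hu0)
  have hle : Submodule.span ℂ (Set.range fun n : ℤ => ρ (sh n) u) ≤
      (Submodule.span ℂ (Set.range fun n : ℤ => ρ (sh n) u)).comap
        (ρ g).toLinearEquiv.toLinearMap := by
    rw [Submodule.span_le]
    rintro _ ⟨n, rfl⟩
    rw [SetLike.mem_coe, Submodule.mem_comap]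
    change ρ g (ρ (sh n) u) ∈ Submodule.span ℂ (Set.range fun n : ℤ => ρ (sh n) u)
    rw [← mul_apply, eq_tr_mul_sh g, mul_assoc, ← sh_add, mul_apply,
      sh_mem_charSpace hu]
    exact Submodule.smul_mem _ _ (Submodule.subset_span ⟨_, rfl⟩)
  exact hle hv

theorem exists_mem_charSpace [FiniteDimensional ℂ H] [Nontrivial H] (ρ : UnitaryRep G H) :
    ∃ χ, ∃ u ∈ charSpace ρ χ, u ≠ 0 := by
  obtain ⟨x, -, hx0, c, hc⟩ := exists_eigenvector_mem (ρ (tr ![1, 0])).toLinearEquiv.toLinearMap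
    (W := ⊤) (fun _ _ => trivial) top_ne_bot
  let T := (ρ (tr ![1, 0])).toLinearEquiv.toLinearMap
  have hinv : ∀ w ∈ Module.End.eigenspace T c,
      (ρ (tr ![0, 1])).toLinearEquiv.toLinearMap w ∈ Module.End.eigenspace T c := by
    intro w hw
    rw [Module.End.mem_eigenspace_iff] at hw ⊢
    change ρ (tr ![1, 0]) (ρ (tr ![0, 1]) w) = c • ρ (tr ![0, 1]) w
    rw [← mul_apply, ← tr_add, add_comm, tr_add, mul_apply, ← map_smul]
    exact congrArg _ hw
  obtain ⟨u, hu, hu0, d, hd⟩ := exists_eigenvector_mem _ hinv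
    ((Submodule.ne_bot_iff _).mpr ⟨x, Module.End.mem_eigenspace_iff.mpr hc, hx0⟩)
  -- The vectors whose translation has `u` as an eigenvector form a subgroup, so the two basis
  -- vectors suffice.
  let K : AddSubgroup (Fin 2 → ℤ) :=
    { carrier := {v | ∃ c : ℂ, ρ (tr v) u = c • u}
      zero_mem' := ⟨1, by rw [tr_zero, one_apply, one_smul]⟩
      add_mem' := by
        rintro v v' ⟨a, ha⟩ ⟨b, hb⟩
        exact ⟨b * a, by rw [tr_add, mul_apply, hb, map_smul, ha, smul_smul]⟩
      neg_mem' := by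
        rintro v ⟨a, ha⟩
        have h1 : u = a • ρ (tr (-v)) u := by
          rw [← map_smul, ← ha, ← mul_apply, ← tr_add, neg_add_cancel, tr_zero, one_apply]
        refine ⟨a⁻¹, ?_⟩
        rw [eq_inv_smul_iff₀, ← h1]
        rintro rfl
        exact hu0 (by simpa using h1) }
  have hK : ∀ v, v ∈ K := fun v => by
    have h1 : (![1, 0] : Fin 2 → ℤ) ∈ K := ⟨c, Module.End.mem_eigenspace_iff.mp hu⟩
    have h2 : (![0, 1] : Fin 2 → ℤ) ∈ K := ⟨d, hd⟩
    convert K.add_mem (K.zsmul_mem h1 (v 0)) (K.zsmul_mem h2 (v 1)) using 1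
    ext i; fin_cases i <;> simp
  choose χ hχ using hK
  exact ⟨χ, u, hχ, hu0⟩

/-! ### The characters in a fixed point -/

/-- The vector `S u` has character χ ∘ M. Were this different from the character of every shift of
`u`, then `S u` would be orthogonal to a spanning set, hence zero. -/
theorem exists_char_M_eq [FiniteDimensional ℂ H] (hρ : IsIrreducible ρ)
    {S : H ≃ₗᵢ[ℂ] H} (hS : ∀ g v, S (ρ (phi g) v) = ρ g (S v))
    (hu : u ∈ charSpace ρ χ) (hu0 : u ≠ 0) :
    ∃ r : ℤ, ∀ v, χ (act M.1 v) = χ (act (A ^ r).1 v) := by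
  have hSu : S u ∈ charSpace ρ (fun v => χ (act M.1 v)) := fun v => by
    rw [← hS, phi_tr, hu, map_smul]
  by_contra! h
  have h0 : S u ∈ (Submodule.span ℂ (Set.range fun n : ℤ => ρ (sh n) u))ᗮ := by
    rw [Submodule.mem_orthogonal]
    have hle : Submodule.span ℂ (Set.range fun n : ℤ => ρ (sh n) u) ≤
        (Submodule.span ℂ {S u})ᗮ := by
      rw [Submodule.span_le]
      rintro _ ⟨n, rfl⟩
      rw [SetLike.mem_coe, Submodule.mem_orthogonal_singleton_iff_inner_right]
      refine inner_eq_zero_of_char_ne hSu (sh_mem_charSpace hu n) fun he => ?_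
      obtain ⟨v, hv⟩ := h (-n)
      exact hv (congrFun he v)
    exact fun x hx => Submodule.mem_orthogonal_singleton_iff_inner_left.mp (hle hx)
  rw [span_orbit_eq_top hρ hu hu0, Submodule.top_orthogonal_eq_bot, Submodule.mem_bot] at h0
  exact hu0 (by simpa using h0)

/-- The hypothesis makes χ invariant under AʳM, and (AʳM)² = AʳA⁻ʳM² = -1. So χ(-v) = χ(v). -/
theorem char_mul_self (hu : u ∈ charSpace ρ χ) (hu0 : u ≠ 0) {r : ℤ}
    (hr : ∀ v, χ (act M.1 v) = χ (act (A ^ r).1 v)) (v : Fin 2 → ℤ) : χ v * χ v = 1 := by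
  have h1 : ∀ w, χ (act (A ^ r).1 (act M.1 w)) = χ w := fun w => by
    have h := hr (act (A ^ (-r)).1 w)
    rw [← act_mul, ← act_mul, ← Matrix.SpecialLinearGroup.coe_mul,
      ← Matrix.SpecialLinearGroup.coe_mul, M_mul_A_zpow, ← zpow_add, neg_neg,
      add_neg_cancel, zpow_zero, Matrix.SpecialLinearGroup.coe_mul, act_mul,
      Matrix.SpecialLinearGroup.coe_one, act_one] at h
    exact h
  have h2 : ∀ w : Fin 2 → ℤ, act (A ^ r).1 (act M.1 (act (A ^ r).1 (act M.1 w))) = -w := by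
    intro w
    rw [← act_mul M.1, ← Matrix.SpecialLinearGroup.coe_mul, M_mul_A_zpow,
      Matrix.SpecialLinearGroup.coe_mul, act_mul, ← act_mul,
      ← Matrix.SpecialLinearGroup.coe_mul, ← zpow_add, add_neg_cancel, zpow_zero,
      Matrix.SpecialLinearGroup.coe_one, act_one, act_M, act_M]
    ext i; fin_cases i <;> simp
  have h3 : χ (-v) = χ v := by rw [← h2, h1, h1]
  rw [← char_zero hu hu0, ← add_neg_cancel v, char_add hu hu0, h3]

theorem eq_of_order_two {χ ψ : (Fin 2 → ℤ) → ℂ} (hχ : ∀ v w, χ (v + w) = χ v * χ w)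
    (hψ : ∀ v w, ψ (v + w) = ψ v * ψ w) (hχ2 : ∀ v, χ v * χ v = 1) (hψ2 : ∀ v, ψ v * ψ v = 1)
    (h₀ : χ ![1, 0] = ψ ![1, 0]) (h₁ : χ ![0, 1] = ψ ![0, 1]) : χ = ψ := by
  have zero : ∀ χ : (Fin 2 → ℤ) → ℂ, (∀ v w, χ (v + w) = χ v * χ w) → (∀ v, χ v * χ v = 1) →
      χ 0 = 1 := fun χ h h2 => by
    rw [← h2 0, ← h, add_zero]
  have neg : ∀ χ : (Fin 2 → ℤ) → ℂ, (∀ v w, χ (v + w) = χ v * χ w) → (∀ v, χ v * χ v = 1) →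
      ∀ v, χ (-v) = χ v := fun χ h h2 v => by
    have h3 : χ v * χ (-v) = χ v * χ v := by
      rw [← h, add_neg_cancel, zero χ h h2, h2]
    exact mul_left_cancel₀ (left_ne_zero_of_mul_eq_one (h2 v)) h3
  let K : AddSubgroup (Fin 2 → ℤ) :=
    { carrier := {v | χ v = ψ v}
      zero_mem' := by rw [Set.mem_ofPred_eq, zero χ hχ hχ2, zero ψ hψ hψ2]
      add_mem' := by
        intro v w (hv : χ v = ψ v) (hw : χ w = ψ w)
        change χ (v + w) = ψ (v + w)
        rw [hχ, hψ, hv, hw]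
      neg_mem' := by
        intro v (hv : χ v = ψ v)
        change χ (-v) = ψ (-v)
        rw [neg χ hχ hχ2, neg ψ hψ hψ2, hv] }
  funext v
  have hv : v ∈ K := by
    have h1 : (![1, 0] : Fin 2 → ℤ) ∈ K := h₀
    have h2 : (![0, 1] : Fin 2 → ℤ) ∈ K := h₁
    convert K.add_mem (K.zsmul_mem h1 (v 0)) (K.zsmul_mem h2 (v 1)) using 1
    ext i; fin_cases i <;> simp
  exact hv

theorem halfChar_values : (halfChar 0 ![1, 0] = -1 ∧ halfChar 0 ![0, 1] = -1) ∧
    (halfChar 1 ![1, 0] = 1 ∧ halfChar 1 ![0, 1] = -1) ∧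
    (halfChar 2 ![1, 0] = -1 ∧ halfChar 2 ![0, 1] = 1) := by
  refine ⟨⟨?_, ?_⟩, ⟨?_, ?_⟩, ⟨?_, ?_⟩⟩
  · change (-1 : ℂ) ^ ((1 : ℤ) + 0) = -1; norm_num
  · change (-1 : ℂ) ^ ((0 : ℤ) + 1) = -1; norm_num
  · change (-1 : ℂ) ^ (0 : ℤ) = 1; norm_num
  · change (-1 : ℂ) ^ (1 : ℤ) = -1; norm_num
  · change (-1 : ℂ) ^ (1 : ℤ) = -1; norm_num
  · change (-1 : ℂ) ^ (0 : ℤ) = 1; norm_num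

theorem halfChar_injective : Function.Injective halfChar := by
  obtain ⟨⟨a0, b0⟩, ⟨a1, b1⟩, ⟨a2, b2⟩⟩ := halfChar_values
  have hne : (-1 : ℂ) ≠ 1 := by norm_num
  have h01 : halfChar 0 ≠ halfChar 1 := fun h => hne (by rw [← a0, h, a1])
  have h02 : halfChar 0 ≠ halfChar 2 := fun h => hne (by rw [← b0, h, b2])
  have h12 : halfChar 1 ≠ halfChar 2 := fun h => hne (by rw [← a2, ← h, a1])
  intro i j hij
  fin_cases i <;> fin_cases j <;> first | rfl | exact absurd hij ‹_› | exact absurd hij.symm ‹_›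

theorem eq_one_or_eq_halfChar {χ : (Fin 2 → ℤ) → ℂ} (hχ : ∀ v w, χ (v + w) = χ v * χ w)
    (hχ2 : ∀ v, χ v * χ v = 1) : χ = 1 ∨ ∃ i, χ = halfChar i := by
  obtain ⟨⟨a0, b0⟩, ⟨a1, b1⟩, ⟨a2, b2⟩⟩ := halfChar_values
  have hh : ∀ i, χ ![1, 0] = halfChar i ![1, 0] → χ ![0, 1] = halfChar i ![0, 1] →
      χ = halfChar i := fun i =>
    eq_of_order_two hχ (halfChar_add i) hχ2 (halfChar_mul_self i)
  rcases mul_self_eq_one_iff.mp (hχ2 ![1, 0]) with h | h <;>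
  rcases mul_self_eq_one_iff.mp (hχ2 ![0, 1]) with h' | h'
  · exact Or.inl (eq_of_order_two hχ (by simp) hχ2 (by simp) h h')
  · exact Or.inr ⟨1, hh 1 (h.trans a1.symm) (h'.trans b1.symm)⟩
  · exact Or.inr ⟨2, hh 2 (h.trans a2.symm) (h'.trans b2.symm)⟩
  · exact Or.inr ⟨0, hh 0 (h.trans a0.symm) (h'.trans b0.symm)⟩

/-! ### Identification of the fixed points -/

/-- When Aᵏ fixes χ, the element `sh k` preserves the χ-space and has an eigenvector there. The sign
restriction on the eigenvalue comes from `phi` inverting `sh k`. -/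
theorem exists_eigenvector_sh [FiniteDimensional ℂ H] (hρ : IsIrreducible ρ)
    {S : H ≃ₗᵢ[ℂ] H} (hS : ∀ g v, S (ρ (phi g) v) = ρ g (S v))
    (hu : u ∈ charSpace ρ χ) (hu0 : u ≠ 0) (k : ℤ)
    (hk : ∀ v, χ (act (A ^ (-k)).1 v) = χ v) :
    ∃ z : ℂ, (z = 1 ∨ z = -1) ∧ ∃ x ∈ charSpace ρ χ, ‖x‖ = 1 ∧ ρ (sh k) x = z • x := by
  obtain ⟨x, hx, hx0, z, hz⟩ := exists_eigenvector_mem (ρ (sh k)).toLinearEquiv.toLinearMap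
    (W := charSpace ρ χ) (fun w hw v => by
      have h := sh_mem_charSpace hw k v
      simp only [hk] at h
      exact h) ((Submodule.ne_bot_iff _).mpr ⟨u, hu, hu0⟩)
  change ρ (sh k) x = z • x at hz
  -- `sh k` commutes with all shifts, and the shifts of `x` span, so `sh k` is scalar.
  have hall : ∀ y, ρ (sh k) y = z • y := fun y => by
    have hle : Submodule.span ℂ (Set.range fun n : ℤ => ρ (sh n) x) ≤
        Module.End.eigenspace (ρ (sh k)).toLinearEquiv.toLinearMap z := by
      rw [Submodule.span_le]
      rintro _ ⟨n, rfl⟩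
      rw [SetLike.mem_coe, Module.End.mem_eigenspace_iff]
      change ρ (sh k) (ρ (sh n) x) = z • ρ (sh n) x
      rw [← mul_apply, ← sh_add, add_comm, sh_add, mul_apply, hz, map_smul]
    rw [span_orbit_eq_top hρ hx hx0] at hle
    exact Module.End.mem_eigenspace_iff.mp (hle (Submodule.mem_top (x := y)))
  have h1 : z • z • S x = S x := by
    have h := hS (sh k) (ρ (sh k) x)
    rw [phi_sh, ← mul_apply, ← sh_add, neg_add_cancel, sh_zero, one_apply, hall, hz, map_smul] at h
    exact h.symm
  refine ⟨z, ?_, (‖x‖⁻¹ : ℂ) • x, Submodule.smul_mem _ _ hx, ?_, ?_⟩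
  · rw [smul_smul] at h1
    have h2 : z * z = 1 := 
      smul_left_injective ℂ (m := S x) (by simpa using hx0) (h1.trans (one_smul ℂ _).symm)
    exact mul_self_eq_one_iff.mp h2
  · rw [norm_smul, norm_inv, Complex.norm_real, norm_norm, inv_mul_cancel₀ (norm_ne_zero_iff.mpr hx0)]
  · rw [map_smul, hz, smul_comm]

/-- The range of `T` is a nonzero invariant subspace, so surjectivity is automatic. -/
theorem Equivalent.of_isometry [FiniteDimensional ℂ H] (hρ : IsIrreducible ρ) {K : Type}
    [NormedAddCommGroup K] [InnerProductSpace ℂ K] [Nontrivial K] {σ : UnitaryRep G K}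
    (T : K →ₗᵢ[ℂ] H) (hT : ∀ g v, T (σ g v) = ρ g (T v)) : Equivalent ρ σ := by
  obtain ⟨k, hk⟩ := exists_ne (0 : K)
  have h := eq_top_of_mem hρ (LinearMap.range T.toLinearMap)
    (by rintro g _ ⟨v, rfl⟩; exact ⟨σ g v, hT g v⟩) ⟨k, rfl⟩
    fun h => hk (T.injective (h.trans (map_zero T).symm))
  let E := LinearIsometryEquiv.ofSurjective T (LinearMap.range_eq_top.mp h)
  refine ⟨E.symm, fun g v => ?_⟩
  rw [LinearIsometryEquiv.symm_apply_eq]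
  change _ = T _
  rw [hT]
  change _ = ρ g (E (E.symm v))
  rw [E.apply_symm_apply]

theorem sh_smul {z : ℂ} (hz : z ≠ 0) {x : H} {k : ℤ} (hx : ρ (sh k) x = z • x) (n : ℤ) :
    ρ (sh (n * k)) x = z ^ n • x := by
  have hneg : ρ (sh (-k)) x = z⁻¹ • x := by
    rw [eq_inv_smul_iff₀ hz, ← map_smul, ← hx, ← mul_apply, ← sh_add, neg_add_cancel, sh_zero,
      one_apply]
  induction n with
  | zero => simp [sh_zero]
  | succ n ih =>
    rw [add_mul, one_mul, sh_add, mul_apply, hx, map_smul, ih, smul_smul, zpow_add_one₀ hz,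
      mul_comm]
  | pred n ih =>
    rw [sub_mul, one_mul, sub_eq_add_neg, sh_add, mul_apply, hneg, map_smul, ih, smul_smul,
      zpow_sub_one₀ hz, mul_comm]

theorem equivalent_of_trivial_char [FiniteDimensional ℂ H] (hρ : IsIrreducible ρ) {x : H}
    (hx : x ∈ charSpace ρ 1) (hx1 : ‖x‖ = 1) {z : ℂ} (hz : z ≠ 0) (hxz : ρ (sh 1) x = z • x)
    {σ : UnitaryRep G ℂ} (hσ : ∀ g c, σ g c = z ^ lvl g * c) : Equivalent ρ σ := by
  refine Equivalent.of_isometry hρ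
    { toLinearMap := LinearMap.toSpanSingleton ℂ H x
      norm_map' := fun c => by simp [norm_smul, hx1] } fun g c => ?_
  change σ g c • x = ρ g (c • x)
  have h := sh_smul hz hxz (lvl g)
  rw [mul_one] at h
  rw [hσ, map_smul, eq_tr_mul_sh g, mul_apply, ← eq_tr_mul_sh, h, map_smul, hx, Pi.one_apply,
    one_smul, smul_smul, mul_comm]

/-- Three successive shifts of `x`, corrected by signs, carry distinct characters and hence form an
orthonormal family on which the group acts as in the model. -/
theorem equivalent_of_halfChar [FiniteDimensional ℂ H] (hρ : IsIrreducible ρ) {x : H}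
    (hx : x ∈ charSpace ρ (halfChar 0)) (hx1 : ‖x‖ = 1) {z : ℂ} (hz : z = 1 ∨ z = -1)
    (hxz : ρ (sh 3) x = z • x) {σ : UnitaryRep G (EuclideanSpace ℂ (ZMod 3))}
    (hσ : ∀ g f, σ g f = z ^ lvl g • rho2 g f) : Equivalent ρ σ := by
  have hz0 : z ≠ 0 := by rcases hz with rfl | rfl <;> norm_num
  have hz2 : z * z = 1 := by rcases hz with rfl | rfl <;> norm_num
  have hznorm : ‖z‖ = 1 := by rcases hz with rfl | rfl <;> simp
  have hzz : ∀ n : ℤ, z ^ n * z ^ n = 1 := fun n => by rw [← mul_zpow, hz2, one_zpow]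
  -- The factor zⁿ makes the family 3-periodic: a period multiplies the vector by z³ · z = z⁴ = 1.
  let w : ℤ → H := fun n => z ^ n • ρ (sh n) x
  have hw_char : ∀ n : ℤ, w n ∈ charSpace ρ (halfChar n) := fun n => by
    have h := sh_mem_charSpace hx n
    simp only [halfChar_zpow] at h
    push_cast at h
    rw [sub_neg_eq_add, zero_add] at h
    exact Submodule.smul_mem _ _ h
  have hw_norm : ∀ n, ‖w n‖ = 1 := fun n => by
    rw [norm_smul, norm_zpow, hznorm, one_zpow, LinearIsometryEquiv.norm_map, hx1, one_mul]
  have hw_sh : ∀ m n, ρ (sh m) (w n) = z ^ m • w (m + n) := fun m n => by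
    simp only [w]
    rw [map_smul, ← mul_apply, ← sh_add, smul_smul, zpow_add₀ hz0, ← mul_assoc, hzz, one_mul]
  have hw_period : ∀ n m, w (n + m * 3) = w n := fun n m => by
    simp only [w]
    rw [sh_add, mul_apply, sh_smul hz0 hxz, map_smul, smul_smul, zpow_add₀ hz0,
      mul_assoc, show m * 3 = m + m + m by ring, zpow_add₀ hz0, zpow_add₀ hz0, hzz, one_mul, hzz,
      mul_one]
  have hw_cast : ∀ n : ℤ, w (n : ZMod 3).val = w n := fun n => by
    rw [ZMod.val_intCast]
    conv_rhs => rw [← Int.emod_add_mul_ediv n 3, mul_comm, hw_period]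
    rfl
  let b := EuclideanSpace.basisFun (ZMod 3) ℂ
  let T₀ := b.toBasis.constr ℂ fun i => w i.val
  have hT₀ : ∀ i, T₀ (b i) = w i.val := fun i => by
    rw [← b.coe_toBasis]; exact b.toBasis.constr_basis ℂ _ i
  have horth : Orthonormal ℂ fun i : ZMod 3 => w i.val := by
    refine ⟨fun i => hw_norm _, fun i j hij => ?_⟩
    refine inner_eq_zero_of_char_ne (hw_char _) (hw_char _) fun h => hij ?_
    simpa using halfChar_injective h
  let T := T₀.isometryOfOrthonormal (v := b.toBasis) (by rw [b.coe_toBasis]; exact b.orthonormal)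
    (by convert horth using 1; funext i; simp only [Function.comp, b.coe_toBasis, hT₀])
  refine Equivalent.of_isometry hρ T fun g f => ?_
  have hb : ∀ i, rho2 g (b i) = halfChar (i + lvl g) (vec g) • b (i + lvl g) := fun i => by
    ext j
    rw [rho2_apply]
    simp only [b, EuclideanSpace.basisFun_apply, PiLp.smul_apply, PiLp.single_apply, sub_eq_iff_eq_add,
      smul_eq_mul]
    split_ifs with h
    · rw [h]
    · simp
  have hlin : T₀ ∘ₗ (σ g).toLinearEquiv.toLinearMap = (ρ g).toLinearEquiv.toLinearMap ∘ₗ T₀ := by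
    refine b.toBasis.ext fun i => ?_
    rw [b.coe_toBasis]
    change T₀ (σ g (b i)) = ρ g (T₀ (b i))
    have hi : ((lvl g + (i.val : ℤ) : ℤ) : ZMod 3) = i + lvl g := by
      push_cast; rw [add_comm]; simp
    have hw1 := hw_char (lvl g + i.val) (vec g)
    rw [hi] at hw1
    conv_rhs => rw [eq_tr_mul_sh g, mul_apply, hT₀, hw_sh, map_smul, hw1]
    rw [hσ, hb, map_smul, map_smul, hT₀, ← hi, hw_cast]
  exact LinearMap.congr_fun hlin f

theorem equivalent_of_fixed [FiniteDimensional ℂ H] (hρ : IsIrreducible ρ)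
    {S : H ≃ₗᵢ[ℂ] H} (hS : ∀ g v, S (ρ (phi g) v) = ρ g (S v)) :
    Equivalent ρ rho1 ∨ Equivalent ρ piRep ∨ Equivalent ρ rho2 ∨ Equivalent ρ rho2pi := by
  have := hρ.1
  obtain ⟨χ, u, hu, hu0⟩ := exists_mem_charSpace ρ
  obtain ⟨r, hr⟩ := exists_char_M_eq hρ hS hu hu0
  rcases eq_one_or_eq_halfChar (char_add hu hu0) (char_mul_self hu hu0 hr) with rfl | ⟨i, rfl⟩
  · obtain ⟨z, hz, x, hx, hx1, hxz⟩ := exists_eigenvector_sh hρ hS hu hu0 1 (fun _ => rfl)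
    have h := fun {σ} => equivalent_of_trivial_char hρ hx hx1 (σ := σ)
      (by rcases hz with rfl | rfl <;> norm_num) hxz
    rcases hz with rfl | rfl
    · exact Or.inl (h fun g c => by simp [rho1, ofCharacter_apply])
    · exact Or.inr (Or.inl (h fun g c => by rw [piRep, ofCharacter_apply, sgn_apply]))
  -- Moving along the orbit replaces the character of index `i` by that of index 0.
  · have hu' := sh_mem_charSpace hu (-(i.val : ℤ))
    simp only [halfChar_zpow] at hu'
    push_cast at hu'
    rw [neg_neg, ZMod.natCast_val, ZMod.cast_id', id, sub_self] at hu'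
    obtain ⟨z, hz, x, hx, hx1, hxz⟩ := exists_eigenvector_sh hρ hS hu' (by simpa using hu0) 3
      (fun v => by rw [halfChar_zpow]; rfl)
    have h := fun {σ} => equivalent_of_halfChar hρ hx hx1 (σ := σ) hz hxz
    rcases hz with rfl | rfl
    · exact Or.inr (Or.inr (Or.inl (h fun g c => by simp)))
    · exact Or.inr (Or.inr (Or.inr (h fun g c => by rw [rho2pi, twist_apply, sgn_apply])))

end

theorem fix_inter_finiteDimensional :
    UnitaryDual.fix phi ∩ UnitaryDual.finiteDimensional G =
      {UnitaryDual.mk rho1 irreducible_rho1, UnitaryDual.mk piRep irreducible_piRep,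
        UnitaryDual.mk rho2 irreducible_rho2, UnitaryDual.mk rho2pi irreducible_rho2pi} := by
  refine Set.Subset.antisymm ?_ ?_
  · rintro _ ⟨hfix, ρ, hfd, rfl⟩
    have hρ : Quotient.mk (unitaryIrrepSetoid G) ρ = UnitaryDual.mk ρ.rep ρ.irreducible := rfl
    rw [hρ] at hfix ⊢
    obtain ⟨S, hS⟩ := (UnitaryDual.mk_mem_fix _).mp hfix
    rcases equivalent_of_fixed ρ.irreducible hS with h | h | h | h
    · exact Or.inl ((UnitaryDual.mk_eq_mk _ _).mpr h)
    · exact Or.inr (Or.inl ((UnitaryDual.mk_eq_mk _ _).mpr h))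
    · exact Or.inr (Or.inr (Or.inl ((UnitaryDual.mk_eq_mk _ _).mpr h)))
    · exact Or.inr (Or.inr (Or.inr ((UnitaryDual.mk_eq_mk _ _).mpr h)))
  · rintro _ (rfl | rfl | rfl | rfl)
    · exact ⟨rho1_mem_fix, (mk_mem_finiteDimensional _).mpr inferInstance⟩
    · exact ⟨piRep_mem_fix, (mk_mem_finiteDimensional _).mpr inferInstance⟩
    · exact ⟨rho2_mem_fix, (mk_mem_finiteDimensional _).mpr inferInstance⟩
    · exact ⟨rho2pi_mem_fix, (mk_mem_finiteDimensional _).mpr inferInstance⟩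

/-! ### The representation on the torus -/

open UnitaryRep

/-- The Hilbert basis of `L²(𝕋²)` consisting of the characters of the torus. -/
noncomputable def torusBasis : HilbertBasis (Fin 2 → ℤ) ℂ L2Torus :=
  UnitAddTorus.mFourierBasis

theorem coeFn_torusBasis (w : Fin 2 → ℤ) :
    torusBasis w =ᵐ[lebesgue] UnitAddTorus.mFourier w := by
  have h : (torusBasis w : L2Torus) = UnitAddTorus.mFourierLp 2 w :=
    congrFun UnitAddTorus.coe_mFourierBasis w
  rw [h]
  exact UnitAddTorus.coeFn_mFourierLp 2 w

theorem torusOp_torusBasis (B : SL(2, ℤ)) (v w : Fin 2 → ℤ) :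
    torusOp B v (torusBasis w) = torusBasis (v + act B.1.transpose w) := by
  refine Lp.ext ?_
  filter_upwards [coeFn_torusOp B v (torusBasis w), coeFn_torusBasis (v + act B.1.transpose w),
    (measurePreserving_act B).quasiMeasurePreserving.ae (coeFn_torusBasis w)] with x h1 h2 h3
  rw [h1, h2, h3, mFourier_act, UnitAddTorus.mFourier_add]

theorem rhoTorus_torusBasis (g : G) (w : Fin 2 → ℤ) :
    rhoTorus g (torusBasis w) = torusBasis (vec g + act (A ^ lvl g).1 w) := by
  have h := torusOp_torusBasis (A ^ lvl g) (vec g) w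
  rw [A_zpow_transpose] at h
  exact h

theorem not_finiteDimensional_L2Torus : ¬ FiniteDimensional ℂ L2Torus := fun _ =>
  not_finite_iff_infinite.mpr inferInstance
    (torusBasis.orthonormal.linearIndependent.finite : Finite (Fin 2 → ℤ))

/-! ### Orbits of the Anosov matrix -/

open Real in
/-- A linear form which is an eigenvector of the transpose of `A`. -/
noncomputable def expandingForm (v : Fin 2 → ℤ) : ℝ := goldenRatio * v 0 + v 1

open Real in
theorem expandingForm_act_A (v : Fin 2 → ℤ) :
    expandingForm (act A.1 v) = goldenRatio ^ 2 * expandingForm v := by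
  have e0 : act A.1 v 0 = 2 * v 0 + v 1 := by simp [act, A]
  have e1 : act A.1 v 1 = v 0 + v 1 := by simp [act, A]
  rw [expandingForm, expandingForm, e0, e1]
  push_cast
  linear_combination (-(v 1 : ℝ) - goldenRatio * v 0 - v 0) * goldenRatio_sq

open Real in
-- An integer zero of the form would make the golden ratio rational.
theorem expandingForm_ne_zero {v : Fin 2 → ℤ} (hv : v ≠ 0) : expandingForm v ≠ 0 := by
  intro h
  by_cases h0 : v 0 = 0
  · refine hv (funext fun i => ?_)
    fin_cases i
    · exact h0
    · simpa [expandingForm, h0] using h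
  · have h1 := (goldenRatio_irrational.mul_intCast h0).add_intCast (v 1)
    exact h1.ne_zero h

open Real in
-- Each application of A multiplies the nonzero value of `expandingForm` by the square of the golden
-- ratio, which exceeds 1, so no value recurs.
theorem act_A_pow_injective {v : Fin 2 → ℤ} (hv : v ≠ 0) :
    Function.Injective fun n : ℕ => act (A ^ (n : ℤ)).1 v := by
  have h : ∀ n : ℕ, expandingForm (act (A ^ (n : ℤ)).1 v) =
      (goldenRatio ^ 2) ^ n * expandingForm v := fun n => by
    induction n with
    | zero => simp [act_one]
    | succ n ih =>
      rw [Nat.cast_succ, add_comm, zpow_add, zpow_one, Matrix.SpecialLinearGroup.coe_mul, act_mul,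
        expandingForm_act_A, ih]
      ring
  intro m n hmn
  have h1 := congrArg expandingForm hmn
  simp only [h] at h1
  exact pow_right_injective₀ (by positivity [goldenRatio_pos])
    (one_lt_pow₀ one_lt_goldenRatio two_ne_zero).ne'
    (mul_right_cancel₀ (expandingForm_ne_zero hv) h1)

/-! ### Irreducibility -/

/-- An invariant vector of the shift has no component along a nontrivial character. -/
theorem inner_torusBasis_eq_zero {f : L2Torus} (hf : ∀ n, rhoTorus (sh n) f = f)
    {v : Fin 2 → ℤ} (hv : v ≠ 0) : inner ℂ (torusBasis v) f = 0 := by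
  have h1 : ∀ n : ℕ, inner ℂ (torusBasis (act (A ^ (n : ℤ)).1 v)) f = inner ℂ (torusBasis v) f := by
    intro n
    have h := (rhoTorus (sh n)).inner_map_map (torusBasis v) f
    rw [hf, rhoTorus_torusBasis, vec_sh, lvl_sh, zero_add] at h
    exact h
  -- Bessel's inequality along an infinite orbit; a summable constant family is zero.
  have h2 : Summable fun n : ℕ => ‖inner ℂ (torusBasis (act (A ^ (n : ℤ)).1 v)) f‖ ^ 2 :=
    (torusBasis.orthonormal.inner_products_summable f).comp_injective (act_A_pow_injective hv)
  simp only [h1] at h2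
  simpa using (summable_const_iff _).mp h2

theorem eq_smul_torusBasis_zero {f : L2Torus} (hf : ∀ n, rhoTorus (sh n) f = f) :
    ∃ c : ℂ, f = c • torusBasis 0 := by
  refine ⟨inner ℂ (torusBasis 0) f, ?_⟩
  have h := torusBasis.hasSum_repr f
  refine h.unique ?_
  rw [← torusBasis.repr_apply_apply]
  refine hasSum_single 0 fun v hv => ?_
  rw [torusBasis.repr_apply_apply, inner_torusBasis_eq_zero hf hv, zero_smul]

/-- The orthogonal projection onto a closed invariant subspace commutes with the action. It sends e₀
to a shift-invariant vector c e₀, and translating gives c on every basis vector, so the subspace is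
0 if c = 0 and everything otherwise. -/
theorem irreducible_rhoTorus : IsIrreducible rhoTorus := by
  refine ⟨⟨torusBasis 0, 0, torusBasis.orthonormal.ne_zero 0⟩, fun W hW hinv => ?_⟩
  have : CompleteSpace W := hW.completeSpace_coe
  have horth : ∀ g, ∀ v ∈ Wᗮ, rhoTorus g v ∈ Wᗮ := fun g v hv => by
    rw [Submodule.mem_orthogonal] at hv ⊢
    intro u hu
    have h := (rhoTorus g).inner_map_map (rhoTorus g⁻¹ u) v
    rw [← UnitaryRep.mul_apply, mul_inv_cancel, one_apply] at h
    rw [h]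
    exact hv _ (hinv _ _ hu)
  have hP : ∀ g v, W.starProjection (rhoTorus g v) = rhoTorus g (W.starProjection v) := by
    intro g v
    refine Submodule.eq_starProjection_of_mem_orthogonal (hinv g _ (Submodule.coe_mem _)) ?_
    rw [← map_sub]
    exact horth g _ (Submodule.sub_starProjection_mem_orthogonal v)
  obtain ⟨c, hc⟩ := eq_smul_torusBasis_zero (f := W.starProjection (torusBasis 0)) fun n => by
    rw [← hP, rhoTorus_torusBasis]; simp
  have hc' : ∀ v, W.starProjection (torusBasis v) = c • torusBasis v := fun v => by
    have h : rhoTorus (tr v) (torusBasis 0) = torusBasis v := by rw [rhoTorus_torusBasis]; simp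
    rw [← h, hP, hc, map_smul]
  have hspan : ∀ K : Submodule ℂ L2Torus, IsClosed (K : Set L2Torus) →
      (∀ v, torusBasis v ∈ K) → K = ⊤ := fun K hK hv => by
    rw [eq_top_iff, ← torusBasis.dense_span]
    exact Submodule.topologicalClosure_minimal _
      (Submodule.span_le.mpr (by rintro _ ⟨v, rfl⟩; exact hv v)) hK
  by_cases hc0 : c = 0
  · left
    have h := hspan Wᗮ W.isClosed_orthogonal fun v => by
      have h1 := Submodule.sub_starProjection_mem_orthogonal (K := W) (torusBasis v)
      rwa [hc', hc0, zero_smul, sub_zero] at h1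
    rwa [Submodule.orthogonal_eq_top_iff] at h
  · right
    refine hspan W hW fun v => ?_
    have h1 : W.starProjection (torusBasis v) ∈ W := Submodule.coe_mem _
    rw [hc'] at h1
    exact (W.smul_mem_iff hc0).mp h1

/-! ### The fixed point -/

theorem torusOp_zero_torusOp_zero (B C : SL(2, ℤ)) (f : L2Torus) :
    torusOp B 0 (torusOp C 0 f) = torusOp (C * B) 0 f := by
  refine Lp.ext ?_
  filter_upwards [coeFn_torusOp B 0 (torusOp C 0 f), coeFn_torusOp (C * B) 0 f,
    (measurePreserving_act B).quasiMeasurePreserving.ae (coeFn_torusOp C 0 f)] with x h1 h2 h3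
  rw [h1, h2, h3, UnitAddTorus.mFourier_zero, Matrix.SpecialLinearGroup.coe_mul, act_mul]
  simp

theorem torusOp_one_zero (f : L2Torus) : torusOp 1 0 f = f := by
  refine Lp.ext ?_
  filter_upwards [coeFn_torusOp 1 0 f] with x h1
  rw [h1, UnitAddTorus.mFourier_zero, Matrix.SpecialLinearGroup.coe_one, act_one]
  simp

/-- The intertwiner is f ↦ f ∘ M. It matches the characters because `M` is orthogonal, and the
shifts because A⁻ⁿM = M Aⁿ. -/
theorem rhoTorus_mem_fix : UnitaryDual.mk rhoTorus irreducible_rhoTorus ∈ UnitaryDual.fix phi := by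
  rw [UnitaryDual.mk_mem_fix]
  let S : L2Torus ≃ₗᵢ[ℂ] L2Torus := LinearIsometryEquiv.ofSurjective (torusOp M 0)
    fun f => ⟨torusOp M⁻¹ 0 f, by
      rw [torusOp_zero_torusOp_zero, inv_mul_cancel, torusOp_one_zero]⟩
  refine ⟨S, fun g f => ?_⟩
  change torusOp M 0 (torusOp (A ^ lvl (phi g)) (vec (phi g)) f) =
    torusOp (A ^ lvl g) (vec g) (torusOp M 0 f)
  have hv : act M.1.transpose (vec (phi g)) = vec g := by
    rw [vec_phi, ← act_mul, show M.1.transpose * M.1 = 1 by decide, act_one]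
  refine Lp.ext ?_
  filter_upwards [coeFn_torusOp M 0 (torusOp (A ^ lvl (phi g)) (vec (phi g)) f),
    coeFn_torusOp (A ^ lvl g) (vec g) (torusOp M 0 f),
    (measurePreserving_act M).quasiMeasurePreserving.ae
      (coeFn_torusOp (A ^ lvl (phi g)) (vec (phi g)) f),
    (measurePreserving_act (A ^ lvl g)).quasiMeasurePreserving.ae
      (coeFn_torusOp M 0 f)] with x h1 h2 h3 h4
  rw [h1, h2, h3, h4, mFourier_act, hv, UnitAddTorus.mFourier_zero, ← act_mul, ← act_mul,
    ← Matrix.SpecialLinearGroup.coe_mul, ← Matrix.SpecialLinearGroup.coe_mul, M_mul_A_zpow,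
    lvl_phi]
  simp

/-! ### The strict inequality and the failure of the conjecture -/

theorem four_lt_encard_fix : 4 < (UnitaryDual.fix phi).encard := by
  have h : (UnitaryDual.fix phi ∩ UnitaryDual.finiteDimensional G).encard = 4 := by
    rw [fix_inter_finiteDimensional, encard_mk_eq_four]
  rw [← h]
  refine Set.Finite.encard_lt_encard (Set.encard_ne_top_iff.mp (by rw [h]; simp))
    ⟨Set.inter_subset_left, fun hle => not_finiteDimensional_L2Torus ?_⟩
  exact (mk_mem_finiteDimensional _).mp (hle rhoTorus_mem_fix).2

instance countable_G : Countable G :=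
  Function.Injective.countable (f := fun g : G => (vec g, lvl g)) fun _ _ h =>
    ext_vec_lvl (congrArg Prod.fst h) (congrArg Prod.snd h)

theorem not_felshtynHillConjecture : ¬ FelshtynHillConjecture := fun h => by
  have h1 := h G phi (Or.inl (by rw [reidemeisterNumber_phi]; exact ENat.natCast_lt_top 4))
  rw [reidemeisterNumber_phi] at h1
  exact four_lt_encard_fix.ne h1

end Anosov

/-- For `G = ℤ² ⋊ ℤ` and `φ((m, k), n) = ((k, -m), -n)`: `R(φ) = 4`; the finite-dimensional fixed
points of `φ̂` are exactly the classes of `ρ₁`, `π`, `ρ₂`, `ρ₂ ⊗ π`, and these are four distinct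
classes; the representation on `L²(𝕋²)` is an infinite-dimensional fixed point; hence
`R(φ) < # Fix φ̂`, and the original conjecture of Fel'shtyn and Hill is false. -/
theorem mainTheorem11 :
    reidemeisterNumber Anosov.phi.toMonoidHom = 4 ∧
    (∃ (h₁ : UnitaryRep.IsIrreducible Anosov.rho1) (h₂ : UnitaryRep.IsIrreducible Anosov.piRep)
      (h₃ : UnitaryRep.IsIrreducible Anosov.rho2) (h₄ : UnitaryRep.IsIrreducible Anosov.rho2pi),
      UnitaryDual.fix Anosov.phi ∩ UnitaryDual.finiteDimensional Anosov.G =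
        {UnitaryDual.mk Anosov.rho1 h₁, UnitaryDual.mk Anosov.piRep h₂,
          UnitaryDual.mk Anosov.rho2 h₃, UnitaryDual.mk Anosov.rho2pi h₄}) ∧
    (UnitaryDual.fix Anosov.phi ∩ UnitaryDual.finiteDimensional Anosov.G).encard = 4 ∧
    (¬ FiniteDimensional ℂ Anosov.L2Torus ∧
      ∃ h : UnitaryRep.IsIrreducible Anosov.rhoTorus,
        UnitaryDual.mk Anosov.rhoTorus h ∈ UnitaryDual.fix Anosov.phi) ∧
    reidemeisterNumber Anosov.phi.toMonoidHom < (UnitaryDual.fix Anosov.phi).encard ∧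
    ¬ FelshtynHillConjecture := by
  refine ⟨Anosov.reidemeisterNumber_phi, ⟨Anosov.irreducible_rho1, Anosov.irreducible_piRep,
    Anosov.irreducible_rho2, Anosov.irreducible_rho2pi, Anosov.fix_inter_finiteDimensional⟩, ?_,
    ⟨Anosov.not_finiteDimensional_L2Torus, Anosov.irreducible_rhoTorus, Anosov.rhoTorus_mem_fix⟩,
    ?_, Anosov.not_felshtynHillConjecture⟩
  · rw [Anosov.fix_inter_finiteDimensional, Anosov.encard_mk_eq_four]
  · rw [Anosov.reidemeisterNumber_phi]
    exact Anosov.four_lt_encard_fix
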